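/- Let $K$ be a finite extension of $\mathbb{Q}_p$ with ring of integers $\mathcal{O}$, uniformizer $\pi$ and residue field of order $q$. Let $R$ be a $\pi$-adically complete (and separated), $\pi$-torsion free $\mathcal{O}$-algebra with a lift of Frobenius $\phi$, i.e. an $\mathcal{O}$-algebra endomorphism with $\phi(r)-r^q\in\pi R$ for all $r\in R$. For an $R$-algebra $C$ let $W_n(C)$ be the ring of $\pi$-typical (ramified) Witt vectors of length $n+1$ over $C$, made into an $R$-algebra by $R\to W_n(R)\to W_n(C)$, where $R\to W_n(R)$ is the ring homomorphism with ghost components $(\mathrm{id},\phi,\dots,\phi^n)$. Regard formal schemes over $R$ as Zariski sheaves on (the opposite of) the category $\mathrm{Nilp}_R$ of $R$-algebras on which $\pi$ is nilpotent that admit an open cover by subfunctors $\mathrm{Spf}(A)$, with $A$ an adic $R$-algebra having an ideal of definition that contains $\pi$. For a functor $G$ from $\mathrm{Nilp}_R$ to groups put $J^nG(C)=G(W_n(C))$ and $N^nG=\ker(J^nG\to G)$, where $J^nG\to G$ is induced by the projection $W_n(C)\to C$ to the first coordinate. Then for every smooth formal group scheme $G$ over $R$ and every integer $n\ge 1$ there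 is an isomorphism of formal group schemes over $R$ $$N^nG\;\simeq\;J^{n-1}(N^1G).$$ -/

import Mathlib

open CategoryTheory

set_option linter.unusedSectionVars false

universe u

/-! ## Ramified (`π`-typical) Witt vectors of finite length

`𝒪` is a domain and `π` a prime element of `𝒪` with finite residue ring `𝒪 ⧸ (π)`, of
cardinality `q`. -/

namespace RamifiedWitt

section Congruences

variable {A : Type*} [CommRing A] {ϖ : A} {q : ℕ}

theorem dvd_pow_sub_pow (hq : ϖ ∣ (q : A)) {k : ℕ} {a b : A}
    (h : ϖ ^ (k + 1) ∣ a - b) : ϖ ^ (k + 2) ∣ a ^ q - b ^ q := by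
  have h1 : ϖ ∣ a - b := (dvd_pow_self ϖ (Nat.succ_ne_zero k)).trans h
  have h2 : ϖ ∣ ∑ i ∈ Finset.range q, a ^ i * b ^ (q - 1 - i) := by
    have e : (∑ i ∈ Finset.range q, a ^ i * b ^ (q - 1 - i)) =
        (∑ i ∈ Finset.range q, (a ^ i - b ^ i) * b ^ (q - 1 - i)) + q * b ^ (q - 1) := by
      have : (q : A) * b ^ (q - 1) = ∑ i ∈ Finset.range q, b ^ i * b ^ (q - 1 - i) := by
        rw [Finset.sum_congr rfl (g := fun _ => b ^ (q - 1))]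
        · simp
        · intro i hi
          rw [← pow_add]
          congr 1
          have := Finset.mem_range.1 hi
          omega
      rw [this, ← Finset.sum_add_distrib]
      exact Finset.sum_congr rfl fun i _ => by ring
    rw [e]
    refine dvd_add (Finset.dvd_sum fun i _ => ?_) (hq.mul_right _)
    exact (h1.trans (sub_dvd_pow_sub_pow a b i)).mul_right _
  rw [← (Commute.all a b).geom_sum₂_mul, pow_succ, mul_comm]
  exact mul_dvd_mul h2 h |>.trans (by rw [mul_comm])

theorem dvd_pow_pow_sub_pow_pow (hq : ϖ ∣ (q : A)) {a b : A} (h : ϖ ∣ a - b) (m : ℕ) :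
    ϖ ^ (m + 1) ∣ a ^ q ^ m - b ^ q ^ m := by
  induction m with
  | zero => simpa using h
  | succ m ih =>
    rw [pow_succ q, pow_mul, pow_mul]
    exact dvd_pow_sub_pow hq ih

end Congruences

variable {𝒪 : Type*} [CommRing 𝒪] (π : 𝒪)

/-- The cardinality `q` of the residue ring `𝒪 ⧸ (π)`. -/
noncomputable def resCard : ℕ := Nat.card (𝒪 ⧸ Ideal.span {π})

/-- The `n`-th ghost polynomial
`w_n = x₀ ^ (q ^ n) + π x₁ ^ (q ^ (n - 1)) + ⋯ + π ^ n x_n`, evaluated at `x`. -/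
noncomputable def ghost {A : Type*} [CommRing A] [Algebra 𝒪 A] (x : ℕ → A) (n : ℕ) : A :=
  ∑ j ∈ Finset.range (n + 1), algebraMap 𝒪 A π ^ j * x j ^ resCard π ^ (n - j)

/-- `A` has no `π`-torsion. -/
class PiTorsionFree (A : Type*) [CommRing A] [Algebra 𝒪 A] : Prop where
  eq_zero : ∀ a : A, algebraMap 𝒪 A π * a = 0 → a = 0

theorem ghost_map {A B : Type*} [CommRing A] [Algebra 𝒪 A] [CommRing B] [Algebra 𝒪 B]
    (f : A →ₐ[𝒪] B) (x : ℕ → A) (n : ℕ) : ghost π (fun i => f (x i)) n = f (ghost π x n) := by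
  simp [ghost, map_sum]

theorem ghost_congr {A : Type*} [CommRing A] [Algebra 𝒪 A] {x y : ℕ → A} {n : ℕ}
    (h : ∀ i ≤ n, x i = y i) : ghost π x n = ghost π y n := by
  refine Finset.sum_congr rfl fun j hj => ?_
  rw [h j (Nat.lt_succ_iff.1 (Finset.mem_range.1 hj))]

theorem ghost_succ {A : Type*} [CommRing A] [Algebra 𝒪 A] (x : ℕ → A) (n : ℕ) :
    ghost π x (n + 1) = (∑ j ∈ Finset.range (n + 1),
      algebraMap 𝒪 A π ^ j * x j ^ resCard π ^ (n + 1 - j)) +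
        algebraMap 𝒪 A π ^ (n + 1) * x (n + 1) := by
  rw [ghost, Finset.sum_range_succ]
  simp

theorem PiTorsionFree.pow_mul_cancel {A : Type*} [CommRing A] [Algebra 𝒪 A] [PiTorsionFree π A]
    (n : ℕ) {a b : A} (h : algebraMap 𝒪 A π ^ n * a = algebraMap 𝒪 A π ^ n * b) : a = b := by
  induction n with
  | zero => simpa using h
  | succ n ih =>
    apply ih
    rw [← sub_eq_zero]
    apply PiTorsionFree.eq_zero (π := π)
    rw [mul_sub, ← mul_assoc, ← mul_assoc, ← pow_succ', h, sub_self]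

theorem eq_of_ghost_eq {A : Type*} [CommRing A] [Algebra 𝒪 A] [PiTorsionFree π A]
    {x y : ℕ → A} {n : ℕ} (h : ∀ i ≤ n, ghost π x i = ghost π y i) : ∀ i ≤ n, x i = y i := by
  intro i
  induction i using Nat.strong_induction_on with
  | _ i ih =>
    intro hi
    have h' := h i hi
    rw [ghost, ghost, Finset.sum_range_succ, Finset.sum_range_succ,
      Finset.sum_congr rfl (g := fun j => algebraMap 𝒪 A π ^ j * y j ^ resCard π ^ (i - j))] at h'
    · have h2 := add_left_cancel h'
      simp only [Nat.sub_self, pow_zero, pow_one] at h2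
      exact PiTorsionFree.pow_mul_cancel π i h2
    · intro j hj
      have hj' := Finset.mem_range.1 hj
      rw [ih j hj' (by omega)]

/-- The ghost vectors in a ring with a lift `ψ` of the `q`-Frobenius satisfy the congruences of
Dwork's lemma. -/
theorem ghost_dvd {A : Type*} [CommRing A] [Algebra 𝒪 A] (ψ : A →ₐ[𝒪] A)
    (hψ : ∀ a, algebraMap 𝒪 A π ∣ ψ a - a ^ resCard π)
    (hq : algebraMap 𝒪 A π ∣ (resCard π : A)) (x : ℕ → A) (n : ℕ) :
    algebraMap 𝒪 A π ^ (n + 1) ∣ ghost π x (n + 1) - ψ (ghost π x n) := by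
  rw [ghost_succ, ghost, map_sum, add_sub_right_comm, ← Finset.sum_sub_distrib]
  refine dvd_add (Finset.dvd_sum fun j hj => ?_) (Dvd.intro _ rfl)
  have hj' := Finset.mem_range.1 hj
  have h1 := dvd_pow_pow_sub_pow_pow hq (hψ (x j)) (n - j)
  have e : n + 1 - j = (n - j) + 1 := by omega
  simp only [map_mul, map_pow, AlgHom.commutes]
  rw [← mul_sub, show n + 1 = j + (n - j + 1) by omega, pow_add]
  refine mul_dvd_mul_left _ ?_
  rw [show j + (n - j + 1) - j = (n - j) + 1 by omega, pow_succ' (resCard π), pow_mul, dvd_sub_comm]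
  exact h1

/-- Dwork's lemma. -/
theorem exists_ghost_eq {A : Type*} [CommRing A] [Algebra 𝒪 A] [PiTorsionFree π A] (ψ : A →ₐ[𝒪] A)
    (hψ : ∀ a, algebraMap 𝒪 A π ∣ ψ a - a ^ resCard π)
    (hq : algebraMap 𝒪 A π ∣ (resCard π : A)) (g : ℕ → A)
    (hg : ∀ n, algebraMap 𝒪 A π ^ (n + 1) ∣ g (n + 1) - ψ (g n)) :
    ∃ x : ℕ → A, ∀ n, ghost π x n = g n := by
  have key : ∀ n, ∃ x : ℕ → A, ∀ i ≤ n, ghost π x i = g i := by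
    intro n
    induction n with
    | zero => exact ⟨fun _ => g 0, fun i hi => by simp [Nat.le_zero.1 hi, ghost]⟩
    | succ n ih =>
      obtain ⟨x, hx⟩ := ih
      have h1 := ghost_dvd π ψ hψ hq x n
      rw [hx n le_rfl] at h1
      obtain ⟨c, hc⟩ := dvd_sub (hg n) h1
      refine ⟨Function.update x (n + 1) (x (n + 1) + c), fun i hi => ?_⟩
      rcases Nat.lt_or_ge i (n + 1) with h | h
      · rw [← hx i (by omega)]
        refine ghost_congr π fun j hj => ?_
        rw [Function.update_of_ne (by omega)]
      · obtain rfl : i = n + 1 := by omega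
        rw [ghost_succ, Finset.sum_congr rfl
          (g := fun j => algebraMap 𝒪 A π ^ j * x j ^ resCard π ^ (n + 1 - j))]
        · rw [Function.update_self, mul_add, ← add_assoc, ← ghost_succ]
          linear_combination -hc
        · intro j hj
          have hj' := Finset.mem_range.1 hj
          rw [Function.update_of_ne (by omega)]
  choose x hx using key
  refine ⟨fun i => x i i, fun n => ?_⟩
  rw [← hx n n le_rfl]
  refine ghost_congr π fun i hi => ?_
  refine eq_of_ghost_eq π (n := i) (fun j hj => ?_) i le_rfl
  rw [hx i j hj, hx n j (hj.trans hi)]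

section StructurePolynomials

variable [IsDomain 𝒪] [hπ : Fact (Prime π)] [hfin : Finite (𝒪 ⧸ Ideal.span {π})]

theorem isPrime_span : (Ideal.span {π}).IsPrime :=
  (Ideal.span_singleton_prime hπ.out.ne_zero).2 hπ.out

theorem resCard_eq : ∃ p f : ℕ, p.Prime ∧ resCard π = p ^ f ∧ π ∣ (p : 𝒪) ∧ f ≠ 0 ∧
    ∀ a : 𝒪, π ∣ a - a ^ resCard π := by
  have := isPrime_span π
  classical
  let _ : Fintype (𝒪 ⧸ Ideal.span {π}) := Fintype.ofFinite _
  let _ : Field (𝒪 ⧸ Ideal.span {π}) := Fintype.fieldOfDomain _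
  obtain ⟨p, hp, n, hpp, hn⟩ := FiniteField.card' (𝒪 ⧸ Ideal.span {π})
  have hc : resCard π = Fintype.card (𝒪 ⧸ Ideal.span {π}) := Nat.card_eq_fintype_card
  refine ⟨p, n, hpp, hc.trans hn, ?_, n.pos.ne', fun a => ?_⟩
  · rw [← Ideal.mem_span_singleton, ← Ideal.Quotient.eq_zero_iff_mem, map_natCast]
    exact CharP.cast_eq_zero _ p
  · rw [← Ideal.mem_span_singleton, ← Ideal.Quotient.eq_zero_iff_mem, map_sub, map_pow, hc,
      FiniteField.pow_card, sub_self]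

theorem dvd_resCard (A : Type*) [CommRing A] [Algebra 𝒪 A] :
    algebraMap 𝒪 A π ∣ (resCard π : A) := by
  obtain ⟨p, f, -, hq, hp, hf, -⟩ := resCard_eq π
  rw [hq, Nat.cast_pow]
  refine dvd_pow ?_ hf
  simpa using map_dvd (algebraMap 𝒪 A) hp

theorem dvd_add_pow (A : Type*) [CommRing A] [Algebra 𝒪 A] (a b : A) :
    algebraMap 𝒪 A π ∣ (a + b) ^ resCard π - (a ^ resCard π + b ^ resCard π) := by
  obtain ⟨p, f, hpp, hq, hp, hf, -⟩ := resCard_eq π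
  obtain ⟨r, hr⟩ := exists_add_pow_prime_pow_eq hpp a b f
  rw [hq, hr, add_sub_cancel_left]
  have : algebraMap 𝒪 A π ∣ (p : A) := by simpa using map_dvd (algebraMap 𝒪 A) hp
  simp only [mul_assoc]
  exact this.mul_right _

theorem dvd_expand_sub_pow {σ : Type*} (P : MvPolynomial σ 𝒪) :
    algebraMap 𝒪 (MvPolynomial σ 𝒪) π ∣ MvPolynomial.expand (resCard π) P - P ^ resCard π := by
  induction P using MvPolynomial.induction_on with
  | C a =>
    obtain ⟨p, f, -, -, -, -, h⟩ := resCard_eq π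
    rw [MvPolynomial.expand_C, ← map_pow, ← map_sub]
    exact map_dvd MvPolynomial.C (h a)
  | add P Q hP hQ =>
    have := dvd_sub (dvd_add hP hQ) (dvd_add_pow π _ P Q)
    rw [map_add]
    convert this using 1
    ring
  | mul_X P s hP =>
    rw [map_mul, MvPolynomial.expand_X, mul_pow, ← sub_mul]
    exact hP.mul_right _

instance (σ : Type*) : PiTorsionFree π (MvPolynomial σ 𝒪) where
  eq_zero a h := by
    rcases mul_eq_zero.1 h with h | h
    · rw [MvPolynomial.algebraMap_eq, MvPolynomial.C_eq_zero] at h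
      exact absurd h hπ.out.ne_zero
    · exact h

/-- Dwork's lemma for polynomial rings. -/
theorem exists_poly {σ : Type*} (g : ℕ → MvPolynomial σ 𝒪)
    (hg : ∀ n, algebraMap 𝒪 (MvPolynomial σ 𝒪) π ^ (n + 1) ∣
      g (n + 1) - MvPolynomial.expand (resCard π) (g n)) :
    ∃ x : ℕ → MvPolynomial σ 𝒪, ∀ n, ghost π x n = g n :=
  exists_ghost_eq π _ (dvd_expand_sub_pow π) (dvd_resCard π _) g hg

theorem ghost_dvd_poly {σ : Type*} (x : ℕ → MvPolynomial σ 𝒪) (n : ℕ) :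
    algebraMap 𝒪 (MvPolynomial σ 𝒪) π ^ (n + 1) ∣
      ghost π x (n + 1) - MvPolynomial.expand (resCard π) (ghost π x n) :=
  ghost_dvd π _ (dvd_expand_sub_pow π) (dvd_resCard π _) x n

theorem exists_addPoly : ∃ S : ℕ → MvPolynomial (ℕ ⊕ ℕ) 𝒪, ∀ n, ghost π S n =
    ghost π (fun i => MvPolynomial.X (Sum.inl i)) n +
      ghost π (fun i => MvPolynomial.X (Sum.inr i)) n := by
  refine exists_poly π _ fun n => ?_
  rw [map_add, add_sub_add_comm]
  exact dvd_add (ghost_dvd_poly π _ n) (ghost_dvd_poly π _ n)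

theorem exists_mulPoly : ∃ S : ℕ → MvPolynomial (ℕ ⊕ ℕ) 𝒪, ∀ n, ghost π S n =
    ghost π (fun i => MvPolynomial.X (Sum.inl i)) n *
      ghost π (fun i => MvPolynomial.X (Sum.inr i)) n := by
  refine exists_poly π _ fun n => ?_
  have h1 := ghost_dvd_poly π (fun i => MvPolynomial.X (R := 𝒪) (Sum.inl (β := ℕ) i)) n
  have h2 := ghost_dvd_poly π (fun i => MvPolynomial.X (R := 𝒪) (Sum.inr (α := ℕ) i)) n
  rw [map_mul]
  convert dvd_add (h1.mul_right (ghost π (fun i => MvPolynomial.X (Sum.inr i)) (n + 1)))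
    (h2.mul_left (MvPolynomial.expand (resCard π)
      (ghost π (fun i => MvPolynomial.X (Sum.inl i)) n))) using 1
  ring

theorem exists_negPoly : ∃ S : ℕ → MvPolynomial ℕ 𝒪, ∀ n, ghost π S n =
    -ghost π (fun i => MvPolynomial.X i) n := by
  refine exists_poly π _ fun n => ?_
  rw [map_neg, ← neg_sub', dvd_neg]
  exact ghost_dvd_poly π _ n

/-- The Witt addition polynomials, characterised by
`w_n(S₀, S₁, …) = w_n(X₀, X₁, …) + w_n(Y₀, Y₁, …)`; `S_n` involves `X_i, Y_i` for `i ≤ n` only. -/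
noncomputable def addPoly : ℕ → MvPolynomial (ℕ ⊕ ℕ) 𝒪 := (exists_addPoly π).choose

/-- The Witt multiplication polynomials. -/
noncomputable def mulPoly : ℕ → MvPolynomial (ℕ ⊕ ℕ) 𝒪 := (exists_mulPoly π).choose

/-- The Witt negation polynomials. -/
noncomputable def negPoly : ℕ → MvPolynomial ℕ 𝒪 := (exists_negPoly π).choose

end StructurePolynomials

end RamifiedWitt

open RamifiedWitt

/-- The set `W_n(A) = A ^ (n + 1)` of `π`-typical Witt vectors of length `n + 1`. -/
@[ext]
structure WittVec {𝒪 : Type*} (π : 𝒪) (n : ℕ) (A : Type*) where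
  /-- The Witt coordinates. -/
  coeff : Fin (n + 1) → A

namespace WittVec

section Ring

variable {𝒪 : Type*} [CommRing 𝒪] {π : 𝒪} {n : ℕ} {A B : Type*} [CommRing A] [Algebra 𝒪 A]
  [CommRing B] [Algebra 𝒪 B]

/-- The coordinates, extended by zero. -/
def ext0 (x : WittVec π n A) (i : ℕ) : A := if h : i < n + 1 then x.coeff ⟨i, h⟩ else 0

/-- The first `n + 1` terms of a sequence, as a Witt vector. -/
def trunc (π : 𝒪) (n : ℕ) (x : ℕ → A) : WittVec π n A := ⟨fun i => x i⟩

theorem ext0_of_le (x : WittVec π n A) {i : ℕ} (h : i ≤ n) :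
    x.ext0 i = x.coeff ⟨i, Nat.lt_succ_of_le h⟩ := dif_pos _

theorem ext0_trunc (x : ℕ → A) {i : ℕ} (h : i ≤ n) : (trunc π n x).ext0 i = x i :=
  dif_pos (Nat.lt_succ_of_le h)

/-- The `i`-th ghost component `w_i`, for `i ≤ n`. -/
noncomputable def ghost (x : WittVec π n A) (i : ℕ) : A := RamifiedWitt.ghost π x.ext0 i

theorem ghost_trunc (x : ℕ → A) {i : ℕ} (h : i ≤ n) :
    (trunc π n x).ghost i = RamifiedWitt.ghost π x i :=
  ghost_congr π fun _ hj => ext0_trunc x (hj.trans h)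

theorem ghost_injective [PiTorsionFree π A] {x y : WittVec π n A}
    (h : ∀ i ≤ n, x.ghost i = y.ghost i) : x = y := by
  ext i
  have := eq_of_ghost_eq π h i (Nat.lt_succ_iff.1 i.2)
  rwa [ext0_of_le _ (Nat.lt_succ_iff.1 i.2), ext0_of_le _ (Nat.lt_succ_iff.1 i.2)] at this

/-- The map `W_n(A) → W_n(B)` that applies `f` to every coordinate. -/
def mapFun (f : A → B) (x : WittVec π n A) : WittVec π n B := ⟨fun i => f (x.coeff i)⟩

theorem ext0_mapFun (f : A →ₐ[𝒪] B) (x : WittVec π n A) (i : ℕ) :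
    (mapFun f x).ext0 i = f (x.ext0 i) := by
  unfold ext0
  split_ifs
  · rfl
  · exact (map_zero f).symm

theorem ghost_mapFun (f : A →ₐ[𝒪] B) (x : WittVec π n A) (i : ℕ) :
    (mapFun f x).ghost i = f (x.ghost i) := by
  unfold ghost
  rw [← ghost_map]
  congr 1
  ext j
  exact ext0_mapFun f x j

theorem mapFun_surjective {f : A → B} (hf : Function.Surjective f) :
    Function.Surjective (mapFun f : WittVec π n A → WittVec π n B) := fun y => by
  choose g hg using hf
  exact ⟨⟨fun i => g (y.coeff i)⟩, by ext i; exact hg _⟩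

variable [IsDomain 𝒪] [hπ : Fact (Prime π)] [hfin : Finite (𝒪 ⧸ Ideal.span {π})]

noncomputable instance : Add (WittVec π n A) :=
  ⟨fun x y => trunc π n fun i => MvPolynomial.aeval (Sum.elim x.ext0 y.ext0) (addPoly π i)⟩

noncomputable instance : Mul (WittVec π n A) :=
  ⟨fun x y => trunc π n fun i => MvPolynomial.aeval (Sum.elim x.ext0 y.ext0) (mulPoly π i)⟩

noncomputable instance : Neg (WittVec π n A) :=
  ⟨fun x => trunc π n fun i => MvPolynomial.aeval x.ext0 (negPoly π i)⟩

instance : Zero (WittVec π n A) := ⟨trunc π n fun _ => 0⟩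

instance : One (WittVec π n A) := ⟨trunc π n fun i => if i = 0 then 1 else 0⟩

theorem ghost_add (x y : WittVec π n A) {i : ℕ} (h : i ≤ n) :
    (x + y).ghost i = x.ghost i + y.ghost i := by
  change (trunc π n _).ghost i = _
  rw [ghost_trunc _ h, ghost_map, addPoly, (exists_addPoly π).choose_spec, map_add, ← ghost_map,
    ← ghost_map]
  simp [ghost]

theorem ghost_mul (x y : WittVec π n A) {i : ℕ} (h : i ≤ n) :
    (x * y).ghost i = x.ghost i * y.ghost i := by
  change (trunc π n _).ghost i = _
  rw [ghost_trunc _ h, ghost_map, mulPoly, (exists_mulPoly π).choose_spec, map_mul, ← ghost_map,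
    ← ghost_map]
  simp [ghost]

theorem ghost_neg (x : WittVec π n A) {i : ℕ} (h : i ≤ n) : (-x).ghost i = -x.ghost i := by
  change (trunc π n _).ghost i = _
  rw [ghost_trunc _ h, ghost_map, negPoly, (exists_negPoly π).choose_spec, map_neg, ← ghost_map]
  simp [ghost]

theorem resCard_pos : resCard π ≠ 0 := Nat.card_pos.ne'

theorem ghost_zero {i : ℕ} (h : i ≤ n) : (0 : WittVec π n A).ghost i = 0 := by
  change (trunc π n _).ghost i = _
  rw [ghost_trunc _ h]
  simp [RamifiedWitt.ghost, resCard_pos]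

theorem ghost_one {i : ℕ} (h : i ≤ n) : (1 : WittVec π n A).ghost i = 1 := by
  change (trunc π n _).ghost i = _
  rw [ghost_trunc _ h, RamifiedWitt.ghost, Finset.sum_range_succ']
  simp [resCard_pos]

theorem mapFun_trunc (f : A → B) (x : ℕ → A) :
    mapFun f (trunc π n x) = trunc π n (fun i => f (x i)) := rfl

theorem mapFun_add (f : A →ₐ[𝒪] B) (x y : WittVec π n A) :
    mapFun f (x + y) = mapFun f x + mapFun f y := by
  ext i
  change f (MvPolynomial.aeval _ (addPoly π i)) = MvPolynomial.aeval _ (addPoly π i)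
  rw [← AlgHom.comp_apply, MvPolynomial.comp_aeval]
  congr 2
  ext (j | j) <;> simp [ext0_mapFun]

theorem mapFun_mul (f : A →ₐ[𝒪] B) (x y : WittVec π n A) :
    mapFun f (x * y) = mapFun f x * mapFun f y := by
  ext i
  change f (MvPolynomial.aeval _ (mulPoly π i)) = MvPolynomial.aeval _ (mulPoly π i)
  rw [← AlgHom.comp_apply, MvPolynomial.comp_aeval]
  congr 2
  ext (j | j) <;> simp [ext0_mapFun]

theorem mapFun_neg (f : A →ₐ[𝒪] B) (x : WittVec π n A) : mapFun f (-x) = -mapFun f x := by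
  ext i
  change f (MvPolynomial.aeval _ (negPoly π i)) = MvPolynomial.aeval _ (negPoly π i)
  rw [← AlgHom.comp_apply, MvPolynomial.comp_aeval]
  congr 2
  ext j
  simp [ext0_mapFun]

theorem mapFun_zero (f : A →ₐ[𝒪] B) : mapFun f (0 : WittVec π n A) = 0 := by
  ext i
  exact map_zero f

theorem mapFun_one (f : A →ₐ[𝒪] B) : mapFun f (1 : WittVec π n A) = 1 := by
  ext i
  change f (if (i : ℕ) = 0 then 1 else 0) = if (i : ℕ) = 0 then 1 else 0
  split_ifs <;> simp

theorem exists_lift (π : 𝒪) (n : ℕ) (A : Type*) [CommRing A] [Algebra 𝒪 A] :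
    Function.Surjective (mapFun (MvPolynomial.aeval (R := 𝒪) (id : A → A)) :
      WittVec π n (MvPolynomial A 𝒪) → WittVec π n A) :=
  mapFun_surjective fun a => ⟨MvPolynomial.X a, by simp⟩

theorem add_assoc_aux (x y z : WittVec π n A) : x + y + z = x + (y + z) := by
  obtain ⟨x, rfl⟩ := exists_lift π n A x
  obtain ⟨y, rfl⟩ := exists_lift π n A y
  obtain ⟨z, rfl⟩ := exists_lift π n A z
  simp only [← mapFun_add]
  exact congrArg _ (ghost_injective fun i hi => by
    simp only [ghost_add _ _ hi, add_assoc])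

theorem zero_add_aux (x : WittVec π n A) : 0 + x = x := by
  obtain ⟨x, rfl⟩ := exists_lift π n A x
  rw [← mapFun_zero (MvPolynomial.aeval (R := 𝒪) (id : A → A))]
  simp only [← mapFun_add]
  exact congrArg _ (ghost_injective fun i hi => by
    simp only [ghost_add _ _ hi, ghost_zero hi, zero_add])

theorem neg_add_cancel_aux (x : WittVec π n A) : -x + x = 0 := by
  obtain ⟨x, rfl⟩ := exists_lift π n A x
  rw [← mapFun_zero (MvPolynomial.aeval (R := 𝒪) (id : A → A))]
  simp only [← mapFun_neg, ← mapFun_add]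
  exact congrArg _ (ghost_injective fun i hi => by
    simp only [ghost_neg _ hi, ghost_add _ _ hi, ghost_zero hi, neg_add_cancel])

theorem add_comm_aux (x y : WittVec π n A) : x + y = y + x := by
  obtain ⟨x, rfl⟩ := exists_lift π n A x
  obtain ⟨y, rfl⟩ := exists_lift π n A y
  simp only [← mapFun_add]
  exact congrArg _ (ghost_injective fun i hi => by
    simp only [ghost_add _ _ hi, add_comm])

theorem left_distrib_aux (x y z : WittVec π n A) : x * (y + z) = x * y + x * z := by
  obtain ⟨x, rfl⟩ := exists_lift π n A x
  obtain ⟨y, rfl⟩ := exists_lift π n A y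
  obtain ⟨z, rfl⟩ := exists_lift π n A z
  simp only [← mapFun_mul, ← mapFun_add]
  exact congrArg _ (ghost_injective fun i hi => by
    simp only [ghost_mul _ _ hi, ghost_add _ _ hi, mul_add])

theorem zero_mul_aux (x : WittVec π n A) : 0 * x = 0 := by
  obtain ⟨x, rfl⟩ := exists_lift π n A x
  rw [← mapFun_zero (MvPolynomial.aeval (R := 𝒪) (id : A → A))]
  simp only [← mapFun_mul]
  exact congrArg _ (ghost_injective fun i hi => by
    simp only [ghost_mul _ _ hi, ghost_zero hi, zero_mul])

theorem mul_assoc_aux (x y z : WittVec π n A) : x * y * z = x * (y * z) := by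
  obtain ⟨x, rfl⟩ := exists_lift π n A x
  obtain ⟨y, rfl⟩ := exists_lift π n A y
  obtain ⟨z, rfl⟩ := exists_lift π n A z
  simp only [← mapFun_mul]
  exact congrArg _ (ghost_injective fun i hi => by
    simp only [ghost_mul _ _ hi, mul_assoc])

theorem one_mul_aux (x : WittVec π n A) : 1 * x = x := by
  obtain ⟨x, rfl⟩ := exists_lift π n A x
  rw [← mapFun_one (MvPolynomial.aeval (R := 𝒪) (id : A → A))]
  simp only [← mapFun_mul]
  exact congrArg _ (ghost_injective fun i hi => by
    simp only [ghost_mul _ _ hi, ghost_one hi, one_mul])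

theorem mul_comm_aux (x y : WittVec π n A) : x * y = y * x := by
  obtain ⟨x, rfl⟩ := exists_lift π n A x
  obtain ⟨y, rfl⟩ := exists_lift π n A y
  simp only [← mapFun_mul]
  exact congrArg _ (ghost_injective fun i hi => by
    simp only [ghost_mul _ _ hi, mul_comm])

noncomputable instance : CommRing (WittVec π n A) where
  add_assoc := add_assoc_aux
  zero_add := zero_add_aux
  add_zero x := (add_comm_aux x 0).trans (zero_add_aux x)
  nsmul := nsmulRec
  zsmul := zsmulRec
  neg_add_cancel := neg_add_cancel_aux
  add_comm := add_comm_aux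
  left_distrib := left_distrib_aux
  right_distrib x y z := by
    rw [mul_comm_aux, left_distrib_aux, mul_comm_aux z x, mul_comm_aux z y]
  zero_mul := zero_mul_aux
  mul_zero x := (mul_comm_aux x 0).trans (zero_mul_aux x)
  mul_assoc := mul_assoc_aux
  one_mul := one_mul_aux
  mul_one x := (mul_comm_aux x 1).trans (one_mul_aux x)
  mul_comm := mul_comm_aux

/-- The ring homomorphism `W_n(f) : W_n(A) → W_n(B)`. -/
noncomputable def map (f : A →ₐ[𝒪] B) : WittVec π n A →+* WittVec π n B where
  toFun := mapFun f
  map_one' := mapFun_one f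
  map_mul' := mapFun_mul f
  map_zero' := mapFun_zero f
  map_add' := mapFun_add f

/-- The projection `w₀ : W_n(A) → A` to the first coordinate. -/
noncomputable def w0 : WittVec π n A →+* A where
  toFun x := x.coeff 0
  map_one' := rfl
  map_zero' := rfl
  map_add' x y := by
    have h := ghost_add x y (Nat.zero_le n)
    simpa [ghost, RamifiedWitt.ghost, ext0] using h
  map_mul' x y := by
    have h := ghost_mul x y (Nat.zero_le n)
    simpa [ghost, RamifiedWitt.ghost, ext0] using h

end Ring

end WittVec

/-! ## Lifts of Frobenius and the `R`-algebra structure on Witt vectors -/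

/-- A lift of the `q`-Frobenius on an `𝒪`-algebra `R`, where `q` is the cardinality of `𝒪 ⧸ (π)`:
an `𝒪`-algebra endomorphism `φ` of `R` with `φ r - r ^ q ∈ π R` for all `r`. -/
structure FrobLift {𝒪 : Type*} [CommRing 𝒪] (π : 𝒪) (R : Type*) [CommRing R] [Algebra 𝒪 R] where
  /-- The endomorphism. -/
  φ : R →ₐ[𝒪] R
  sub_pow_mem : ∀ r : R, φ r - r ^ resCard π ∈ Ideal.span {algebraMap 𝒪 R π}

namespace WittVec

variable {𝒪 : Type*} [CommRing 𝒪] {π : 𝒪} [IsDomain 𝒪] [hπ : Fact (Prime π)]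
  [hfin : Finite (𝒪 ⧸ Ideal.span {π})] {R : Type*} [CommRing R] [Algebra 𝒪 R] [PiTorsionFree π R]

theorem exists_exp (φ : FrobLift π R) (n : ℕ) (r : R) :
    ∃ x : WittVec π n R, ∀ i ≤ n, x.ghost i = φ.φ^[i] r := by
  obtain ⟨x, hx⟩ := exists_ghost_eq π φ.φ
    (fun a => Ideal.mem_span_singleton.1 (φ.sub_pow_mem a)) (dvd_resCard π R)
    (fun i => φ.φ^[i] r) (fun i => by simp only [Function.iterate_succ_apply', sub_self, dvd_zero])
  exact ⟨trunc π n x, fun i hi => by rw [ghost_trunc _ hi, hx]⟩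

/-- The Witt vector with ghost components `(r, φ r, …, φ ^ n r)`. -/
noncomputable def expFun (φ : FrobLift π R) (n : ℕ) (r : R) : WittVec π n R :=
  (exists_exp φ n r).choose

theorem ghost_expFun (φ : FrobLift π R) (n : ℕ) (r : R) {i : ℕ} (hi : i ≤ n) :
    (expFun φ n r).ghost i = φ.φ^[i] r := (exists_exp φ n r).choose_spec i hi

/-- The ring homomorphism `exp : R → W_n(R)` with ghost components `(id, φ, …, φ ^ n)`. -/
noncomputable def exp (φ : FrobLift π R) (n : ℕ) : R →+* WittVec π n R where
  toFun := expFun φ n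
  map_one' := ghost_injective fun i hi => by
    rw [ghost_expFun φ n _ hi, ghost_one hi, iterate_map_one]
  map_mul' x y := ghost_injective fun i hi => by
    rw [ghost_mul _ _ hi, ghost_expFun φ n _ hi, ghost_expFun φ n _ hi, ghost_expFun φ n _ hi,
      iterate_map_mul]
  map_zero' := ghost_injective fun i hi => by
    rw [ghost_expFun φ n _ hi, ghost_zero hi, iterate_map_zero]
  map_add' x y := ghost_injective fun i hi => by
    rw [ghost_add _ _ hi, ghost_expFun φ n _ hi, ghost_expFun φ n _ hi, ghost_expFun φ n _ hi,
      iterate_map_add]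

theorem exp_coeff_zero (φ : FrobLift π R) (n : ℕ) (r : R) : (exp φ n r).coeff 0 = r := by
  have h := ghost_expFun φ n r (Nat.zero_le n)
  change (expFun φ n r).coeff 0 = r
  simpa [ghost, RamifiedWitt.ghost, ext0] using h

theorem ghost_exp (φ : FrobLift π R) (n : ℕ) (r : R) {i : ℕ} (hi : i ≤ n) :
    (exp φ n r).ghost i = φ.φ^[i] r := ghost_expFun φ n r hi

theorem dvd_exp_coeff (φ : FrobLift π R) (n N : ℕ) : ∀ (i : ℕ) (hi : i ≤ n),
    algebraMap 𝒪 R π ^ (N + (n - i)) ∣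
      (exp φ n (algebraMap 𝒪 R π ^ (N + n))).coeff ⟨i, Nat.lt_succ_of_le hi⟩ := by
  intro i
  induction i using Nat.strong_induction_on with
  | _ i ih =>
    intro hi
    have h := ghost_exp φ n (algebraMap 𝒪 R π ^ (N + n)) hi
    rw [iterate_map_pow] at h
    have hf : φ.φ^[i] (algebraMap 𝒪 R π) = algebraMap 𝒪 R π :=
      Function.iterate_fixed (φ.φ.commutes π) i
    rw [hf, ghost, RamifiedWitt.ghost, Finset.sum_range_succ, Nat.sub_self, pow_zero, pow_one,
      ext0_of_le _ hi] at h
    have h1 : algebraMap 𝒪 R π ^ (N + n) ∣ ∑ j ∈ Finset.range i, algebraMap 𝒪 R π ^ j *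
        (exp φ n (algebraMap 𝒪 R π ^ (N + n))).ext0 j ^ resCard π ^ (i - j) := by
      refine Finset.dvd_sum fun j hj => ?_
      have hj' := Finset.mem_range.1 hj
      rw [ext0_of_le _ (hj'.le.trans hi)]
      have e : algebraMap 𝒪 R π ^ (N + n) =
          algebraMap 𝒪 R π ^ j * algebraMap 𝒪 R π ^ (N + (n - j)) := by
        rw [← pow_add]
        congr 1
        omega
      refine e.dvd.trans (mul_dvd_mul_left _ ((ih j hj' (hj'.le.trans hi)).trans ?_))
      exact dvd_pow_self _ (pow_ne_zero _ resCard_pos)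
    have h2 := (dvd_add_right h1).1 (Dvd.intro_left 1 (by rw [one_mul, h]))
    obtain ⟨c, hc⟩ := h2
    refine ⟨c, PiTorsionFree.pow_mul_cancel π i ?_⟩
    rw [hc, ← mul_assoc, ← pow_add, show i + (N + (n - i)) = N + n by omega]

variable {C : Type*} [CommRing C] [Algebra 𝒪 C] [Algebra R C] [IsScalarTower 𝒪 R C]

/-- The `R`-algebra structure `R → W_n(R) → W_n(C)` of the Witt vectors of an `R`-algebra `C`. -/
@[reducible]
noncomputable def algebra (φ : FrobLift π R) (n : ℕ) (C : Type*) [CommRing C] [Algebra 𝒪 C]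
    [Algebra R C] [IsScalarTower 𝒪 R C] : Algebra R (WittVec π n C) :=
  ((map (IsScalarTower.toAlgHom 𝒪 R C)).comp (exp φ n)).toAlgebra

theorem isNilpotent (φ : FrobLift π R) (n : ℕ)
    (h : IsNilpotent (algebraMap R C (algebraMap 𝒪 R π))) :
    IsNilpotent (map (IsScalarTower.toAlgHom 𝒪 R C) (exp φ n (algebraMap 𝒪 R π))) := by
  obtain ⟨N, hN⟩ := h
  refine ⟨N + n, ?_⟩
  rw [← map_pow, ← map_pow]
  ext i
  obtain ⟨c, hc⟩ := dvd_exp_coeff φ n N i (Nat.lt_succ_iff.1 i.2)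
  change algebraMap R C (coeff _ _) = 0
  rw [hc, map_mul, map_pow, pow_add, hN, zero_mul, zero_mul]

end WittVec

/-! ## Formal schemes over `R` as sheaves on `R`-algebras on which `ϖ` is nilpotent -/

/-- The category of `R`-algebras on which `ϖ` is nilpotent. -/
abbrev Nilp {R : Type u} [CommRing R] (ϖ : R) : Type (u + 1) :=
  ObjectProperty.FullSubcategory fun C : CommAlgCat.{u} R => IsNilpotent (algebraMap R C ϖ)

section FormalSchemes

variable {R : Type u} [CommRing R] {ϖ : R}

namespace Nilp

/-- The localization `C[1/f]`. -/
noncomputable def away (C : Nilp ϖ) (f : C.obj) : Nilp ϖ where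
  obj := CommAlgCat.of R (Localization.Away f)
  property := by
    have h := C.property.map (algebraMap C.obj (Localization.Away f))
    rwa [← IsScalarTower.algebraMap_apply] at h

/-- The localization map `C → C[1/f]`. -/
noncomputable def toAway (C : Nilp ϖ) (f : C.obj) : C ⟶ C.away f :=
  ObjectProperty.homMk (CommAlgCat.ofHom (IsScalarTower.toAlgHom R C.obj (Localization.Away f)))

end Nilp

/-- `F` is a sheaf for the Zariski topology on the opposite of `Nilp ϖ`: for all elements
`f ∈ s` of `C` that generate the unit ideal, compatible sections over the `C[1/f]` glue uniquely. -/
def IsZariskiSheaf (F : Nilp ϖ ⥤ Type u) : Prop :=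
  ∀ (C : Nilp ϖ) (s : Set C.obj), Ideal.span s = ⊤ →
    ∀ x : ∀ f : s, F.obj (C.away f.1),
      (∀ (f g : s) (D : Nilp ϖ) (a : C.away f.1 ⟶ D) (b : C.away g.1 ⟶ D),
        C.toAway f.1 ≫ a = C.toAway g.1 ≫ b → F.map a (x f) = F.map b (x g)) →
      ∃! y : F.obj C, ∀ f : s, F.map (C.toAway f.1) y = x f

/-- The formal spectrum of `A` with ideal of definition `I`:
`Spf(A)(C) = colim_k Hom_R(A / I ^ k, C)`, the set of `R`-algebra homomorphisms `A → C` that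
vanish on some power of `I`. -/
def Spf (ϖ : R) (A : Type u) [CommRing A] [Algebra R A] (I : Ideal A) : Nilp ϖ ⥤ Type u where
  obj C := {f : A →ₐ[R] C.obj // ∃ k : ℕ, I ^ k ≤ RingHom.ker f}
  map g := ↾ fun f => ⟨g.hom.hom.comp f.1, f.2.imp fun k hk a ha => by
    have h : f.1 a = 0 := hk ha
    change g.hom.hom (f.1 a) = 0
    rw [h, map_zero]⟩

/-- A subfunctor `U` of `F` is open if for every point `x` of `F` with values in `C`, the locus
where `x` lies in `U` is an open subset `Spec C ∖ V(J)` of `Spec C`. -/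
def IsOpenSubfunctor {F : Nilp ϖ ⥤ Type u} (U : Subfunctor F) : Prop :=
  ∀ (C : Nilp ϖ) (x : F.obj C), ∃ J : Ideal C.obj, ∀ (D : Nilp ϖ) (g : C ⟶ D),
    F.map g x ∈ U.obj D ↔ J.map g.hom.hom = ⊤

/-- `F` is covered, locally for the Zariski topology, by open subfunctors with property `P`. -/
def HasOpenCover (P : (Nilp ϖ ⥤ Type u) → Prop) (F : Nilp ϖ ⥤ Type u) : Prop :=
  ∃ 𝒰 : Set (Subfunctor F), (∀ U ∈ 𝒰, IsOpenSubfunctor U ∧ P U.toFunctor) ∧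
    ∀ (C : Nilp ϖ) (x : F.obj C), ∃ s : Set C.obj, Ideal.span s = ⊤ ∧
      ∀ f ∈ s, ∃ U ∈ 𝒰, F.map (C.toAway f) x ∈ U.obj (C.away f)

/-- `F` is isomorphic to `Spf(A)` for an adic `R`-algebra `A` (complete and separated) that has
an ideal of definition containing `ϖ`. -/
def IsFormalAffine (F : Nilp ϖ ⥤ Type u) : Prop :=
  ∃ (A : CommAlgCat.{u} R) (I : Ideal A), IsAdicComplete I A ∧ algebraMap R A ϖ ∈ I ∧
    Nonempty (F ≅ Spf ϖ A I)

open scoped TensorProduct in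
/-- `F` is isomorphic to `Spf(A)` for a `ϖ`-adically complete and separated `R`-algebra `A` with
its `ϖ`-adic topology, such that `A / ϖ ^ m` is a smooth `R / ϖ ^ m`-algebra for all `m`. -/
def IsSmoothFormalAffine (F : Nilp ϖ ⥤ Type u) : Prop :=
  ∃ A : CommAlgCat.{u} R, IsAdicComplete (Ideal.span {algebraMap R A ϖ}) A ∧
    (∀ m : ℕ, Algebra.Smooth (R ⧸ Ideal.span {ϖ ^ m}) ((R ⧸ Ideal.span {ϖ ^ m}) ⊗[R] A)) ∧
    Nonempty (F ≅ Spf ϖ A (Ideal.span {algebraMap R A ϖ}))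

/-- Formal schemes over `R`: Zariski sheaves with an open cover by formal spectra. -/
def IsFormalScheme (F : Nilp ϖ ⥤ Type u) : Prop :=
  IsZariskiSheaf F ∧ HasOpenCover IsFormalAffine F

/-- Smooth formal schemes over `R`. -/
def IsSmoothFormalScheme (F : Nilp ϖ ⥤ Type u) : Prop :=
  IsFormalScheme F ∧ HasOpenCover IsSmoothFormalAffine F

/-- Smooth formal group schemes over `R`: functors to groups whose underlying functor to sets is
a smooth formal scheme over `R`. -/
def IsSmoothFormalGroupScheme (G : Nilp ϖ ⥤ GrpCat.{u}) : Prop :=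
  IsSmoothFormalScheme (G ⋙ forget GrpCat.{u})

/-- The kernel of a homomorphism of functors to groups. -/
def groupKernel {G H : Nilp ϖ ⥤ GrpCat.{u}} (α : G ⟶ H) : Nilp ϖ ⥤ GrpCat.{u} where
  obj C := GrpCat.of (α.app C).hom.ker
  map {C D} f := GrpCat.ofHom
    (((G.map f).hom.comp (α.app C).hom.ker.subtype).codRestrict (α.app D).hom.ker fun x => by
      have h := ConcreteCategory.congr_hom (α.naturality f) x.1
      have hx : α.app C x.1 = 1 := x.2
      have h' : α.app D (G.map f x.1) = H.map f (α.app C x.1) := h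
      rw [hx, map_one] at h'
      exact h')

end FormalSchemes

/-! ## Arithmetic jets -/

section Jets

variable {𝒪 : Type*} [CommRing 𝒪] {π : 𝒪} [IsDomain 𝒪] [hπ : Fact (Prime π)]
  [hfin : Finite (𝒪 ⧸ Ideal.span {π})] {R : Type u} [CommRing R] [Algebra 𝒪 R]
  [PiTorsionFree π R]

/-- An `R`-algebra is an `𝒪`-algebra by restriction of scalars. -/
@[reducible]
def restrictAlgebra (𝒪 : Type*) [CommRing 𝒪] {R : Type u} [CommRing R] [Algebra 𝒪 R]
    (C : CommAlgCat.{u} R) : Algebra 𝒪 C := Algebra.compHom C (algebraMap 𝒪 R)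

attribute [local instance] restrictAlgebra

theorem restrictAlgebra_tower (C : CommAlgCat.{u} R) : IsScalarTower 𝒪 R C :=
  IsScalarTower.of_algebraMap_eq' rfl

attribute [local instance] restrictAlgebra_tower

/-- The `R`-algebra `W_n(C)`, for an `R`-algebra `C` on which `π` is nilpotent. -/
noncomputable def wittObj (φ : FrobLift π R) (n : ℕ) (C : Nilp (algebraMap 𝒪 R π)) :
    Nilp (algebraMap 𝒪 R π) where
  obj := @CommAlgCat.of R _ (WittVec π n C.obj) _ (WittVec.algebra φ n C.obj)
  property := WittVec.isNilpotent φ n C.property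

/-- The functor `W_n` on `R`-algebras on which `π` is nilpotent. -/
noncomputable def wittFunctor (φ : FrobLift π R) (n : ℕ) :
    Nilp (algebraMap 𝒪 R π) ⥤ Nilp (algebraMap 𝒪 R π) where
  obj := wittObj φ n
  map {C D} f := ObjectProperty.homMk (ConcreteCategory.ofHom (C := CommAlgCat R)
    (X := (wittObj φ n C).obj) (Y := (wittObj φ n D).obj)
    { WittVec.map (f.hom.hom.restrictScalars 𝒪) with
      commutes' := fun r => WittVec.ext (funext fun i => f.hom.hom.commutes _) })

/-- The natural projection `w₀ : W_n(C) → C`. -/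
noncomputable def wittProj (φ : FrobLift π R) (n : ℕ) :
    wittFunctor φ n ⟶ 𝟭 (Nilp (algebraMap 𝒪 R π)) where
  app C := ObjectProperty.homMk (ConcreteCategory.ofHom (C := CommAlgCat R)
    (X := (wittObj φ n C).obj) (Y := C.obj)
    { WittVec.w0 with
      commutes' := fun r => congrArg (algebraMap R C.obj) (WittVec.exp_coeff_zero φ n r) })

/-- The `n`-th jet `J^n G` of a functor to groups: `J^n G (C) = G (W_n(C))`. -/
noncomputable def jet (φ : FrobLift π R) (n : ℕ) (G : Nilp (algebraMap 𝒪 R π) ⥤ GrpCat.{u}) :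
    Nilp (algebraMap 𝒪 R π) ⥤ GrpCat.{u} :=
  wittFunctor φ n ⋙ G

/-- The natural morphism `u : J^n G → G`. -/
noncomputable def jetProj (φ : FrobLift π R) (n : ℕ)
    (G : Nilp (algebraMap 𝒪 R π) ⥤ GrpCat.{u}) : jet φ n G ⟶ G where
  app C := G.map ((wittProj φ n).app C)
  naturality C D f := by
    have h := (wittProj φ n).naturality f
    change G.map _ ≫ G.map _ = G.map _ ≫ G.map _
    rw [← G.map_comp, ← G.map_comp]
    exact congrArg G.map h

/-- `N^n G`, the kernel of `u : J^n G → G`. -/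
noncomputable def jetKernel (φ : FrobLift π R) (n : ℕ)
    (G : Nilp (algebraMap 𝒪 R π) ⥤ GrpCat.{u}) : Nilp (algebraMap 𝒪 R π) ⥤ GrpCat.{u} :=
  groupKernel (jetProj φ n G)

end Jets

/-! ## The base ring -/

section LocalField

variable {p : ℕ} [Fact p.Prime] {K : Type*} [Field K] [Algebra ℚ_[p] K]
  [FiniteDimensional ℚ_[p] K] [Algebra ℤ_[p] K] [IsScalarTower ℤ_[p] ℚ_[p] K]

/-- The residue field of the ring of integers of a finite extension of `ℚ_p` is finite. -/
instance finite_residue (π : integralClosure ℤ_[p] K) [hπ : Fact (Prime π)] :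
    Finite (integralClosure ℤ_[p] K ⧸ Ideal.span {π}) := by
  have hprime : (Ideal.span {π}).IsPrime := (Ideal.span_singleton_prime hπ.out.ne_zero).2 hπ.out
  have hfinite : Module.Finite ℤ_[p] (integralClosure ℤ_[p] K) :=
    IsIntegralClosure.finite ℤ_[p] ℚ_[p] K (integralClosure ℤ_[p] K)
  have hne : (Ideal.span {π}).comap (algebraMap ℤ_[p] (integralClosure ℤ_[p] K)) ≠ ⊥ :=
    Ideal.comap_ne_bot_of_integral_mem hπ.out.ne_zero (Ideal.mem_span_singleton_self π)
      (Algebra.IsIntegral.isIntegral π)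
  have hmax : (Ideal.span {π}).comap (algebraMap ℤ_[p] (integralClosure ℤ_[p] K)) =
      IsLocalRing.maximalIdeal ℤ_[p] :=
    IsLocalRing.eq_maximalIdeal (Ring.DimensionLEOne.maximalOfPrime hne inferInstance)
  have hres : Finite (ℤ_[p] ⧸ (Ideal.span {π}).comap
      (algebraMap ℤ_[p] (integralClosure ℤ_[p] K))) := by
    rw [hmax]
    exact Finite.of_equiv (ZMod p) PadicInt.residueField.symm.toEquiv
  have hfin' : Module.Finite ℤ_[p] (integralClosure ℤ_[p] K ⧸ Ideal.span {π}) := inferInstance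
  let _ : Algebra (ℤ_[p] ⧸ (Ideal.span {π}).comap (algebraMap ℤ_[p] (integralClosure ℤ_[p] K)))
      (integralClosure ℤ_[p] K ⧸ Ideal.span {π}) :=
    Ideal.Quotient.algebraQuotientOfLEComap le_rfl
  have htower : IsScalarTower ℤ_[p]
      (ℤ_[p] ⧸ (Ideal.span {π}).comap (algebraMap ℤ_[p] (integralClosure ℤ_[p] K)))
      (integralClosure ℤ_[p] K ⧸ Ideal.span {π}) := IsScalarTower.of_algebraMap_eq' rfl
  have := Module.Finite.of_restrictScalars_finite ℤ_[p]
    (ℤ_[p] ⧸ (Ideal.span {π}).comap (algebraMap ℤ_[p] (integralClosure ℤ_[p] K)))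
    (integralClosure ℤ_[p] K ⧸ Ideal.span {π})
  exact Module.finite_of_finite
    (ℤ_[p] ⧸ (Ideal.span {π}).comap (algebraMap ℤ_[p] (integralClosure ℤ_[p] K)))

end LocalField

/-! ## The homomorphism `W_1(W_m(C)) → W_{m+1}(C)` -/

namespace RamifiedWitt

variable {𝒪 : Type*} [CommRing 𝒪] (π : 𝒪) [IsDomain 𝒪] [hπ : Fact (Prime π)]
  [hfin : Finite (𝒪 ⧸ Ideal.span {π})]

/-! Write n = m + 1. The key point is an identity of rings, natural in `C`: W_1(W_m(C)) is the fibre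
product of W_{m+1}(C) and W_m(C) over `C`. An element of W_1(W_m(C)) has two rows of ghost
components, (a₀, …, a_m) and (b₀, …, b_m). The map to W_m(C) keeps the first row, the map to
W_{m+1}(C) keeps (a₀, b₀, …, b_m), and the two results share only a₀. The second map has a formula
over every ring: (x, y) goes to the sum of the vector with ghost components (w₀(x), w₀(x)^q, …,
w_m(x)^q) and the Verschiebung of y. Such a vector exists by Dwork's lemma (`exists_shiftPoly`).
Since the Verschiebung is a bijection onto the vectors with zeroth coordinate 0, y can be recovered
from x and the sum (`existsUnique_contractFun`).

If π is nilpotent in `C`, the kernel of the surjection W_{m+1}(C) → C is nil, so Spec C and Spec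
W_{m+1}(C) have the same open sets. A formal scheme G therefore carries this square to a fibre
product of sets (`IsNilSquare.existsUnique`): this is immediate for Spf(A), passes to open
subfunctors because membership can be tested modulo a nil ideal, and glues by the sheaf property.

Taking the fibre over 1 in G(W_m(C)) gives the theorem: the kernel of G(W_1(W_m(C))) → G(W_m(C)),
which is J^m(N^1 G)(C), is identified with the kernel of G(W_{m+1}(C)) → G(C), which is N^{m+1}
G(C). The identification is induced by a natural ring homomorphism, hence is a natural isomorphism
of groups. -/

theorem exists_shiftPoly : ∃ S : ℕ → MvPolynomial ℕ 𝒪,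
    ghost π S 0 = ghost π (fun i => MvPolynomial.X i) 0 ∧
      ∀ n, ghost π S (n + 1) = ghost π (fun i => MvPolynomial.X i) n ^ resCard π := by
  obtain ⟨S, hS⟩ := exists_poly π (σ := ℕ)
    (fun n => Nat.casesOn n (ghost π (fun i => MvPolynomial.X i) 0)
      fun k => ghost π (fun i => MvPolynomial.X i) k ^ resCard π) (by
    -- Dwork's congruences for (w₀, w₀^q, w₁^q, …). The first is an equality, since the Frobenius
    -- lift sends X₀ to X₀^q. In the later ones the shift of index requires one more factor π than
    -- the congruence between w_{k+1} and the lift of w_k provides; raising to the q-th power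
    -- supplies it.
    rintro (_ | k)
    · simp [ghost]
    · simp only [map_pow]
      exact dvd_pow_sub_pow (dvd_resCard π _) (ghost_dvd_poly π _ k))
  exact ⟨S, hS 0, fun n => hS (n + 1)⟩

/-- Polynomials with ghost components `(w₀, w₀ ^ q, w₁ ^ q, w₂ ^ q, …)`. -/
noncomputable def shiftPoly : ℕ → MvPolynomial ℕ 𝒪 := (exists_shiftPoly π).choose

end RamifiedWitt

namespace WittVec

/-! ### Verschiebung, shifted q-th powers and nilpotence. -/

section Shift

variable {𝒪 : Type*} [CommRing 𝒪] {π : 𝒪} {m : ℕ} {A B : Type*} [CommRing A] [Algebra 𝒪 A]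
  [CommRing B] [Algebra 𝒪 B]

/-- The shift `(x₀, …, x_m) ↦ (0, x₀, …, x_m)`. -/
def verschiebung (x : WittVec π m A) : WittVec π (m + 1) A :=
  ⟨Fin.cons (α := fun _ => A) 0 x.coeff⟩

theorem ext0_verschiebung_zero (x : WittVec π m A) : (verschiebung x).ext0 0 = 0 := by
  simp [ext0, verschiebung]

theorem ext0_verschiebung_succ (x : WittVec π m A) (i : ℕ) :
    (verschiebung x).ext0 (i + 1) = x.ext0 i := by
  unfold ext0
  by_cases h : i < m + 1
  · rw [dif_pos h, dif_pos (Nat.succ_lt_succ h)]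
    rfl
  · rw [dif_neg h, dif_neg (by omega)]

theorem mapFun_verschiebung (f : A →ₐ[𝒪] B) (x : WittVec π m A) :
    mapFun f (verschiebung x) = verschiebung (mapFun f x) := by
  ext i
  refine Fin.cases ?_ (fun j => ?_) i
  · exact map_zero f
  · rfl

theorem verschiebung_injective :
    Function.Injective (verschiebung : WittVec π m A → WittVec π (m + 1) A) := fun x y h => by
  ext i
  have := congrArg (fun z => z.coeff i.succ) h
  exact this

theorem exists_verschiebung_eq (x : WittVec π (m + 1) A) (h : x.coeff 0 = 0) :
    ∃ y, verschiebung y = x := by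
  refine ⟨⟨fun i => x.coeff i.succ⟩, ?_⟩
  ext i
  refine Fin.cases ?_ (fun j => ?_) i
  · exact h.symm
  · rfl

theorem ghost_zero_eq (x : WittVec π m A) : x.ghost 0 = x.coeff 0 := by
  simp [ghost, RamifiedWitt.ghost, ext0]

theorem ghost_one_eq (x : WittVec π 1 A) :
    x.ghost 1 = x.coeff 0 ^ resCard π + algebraMap 𝒪 A π * x.coeff 1 := by
  simp [ghost, RamifiedWitt.ghost, ext0, Finset.sum_range_succ]

variable [IsDomain 𝒪] [hπ : Fact (Prime π)] [hfin : Finite (𝒪 ⧸ Ideal.span {π})]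

theorem ghost_verschiebung_zero (x : WittVec π m A) : (verschiebung x).ghost 0 = 0 := by
  rw [ghost_zero_eq]
  rfl

theorem ghost_verschiebung_succ (x : WittVec π m A) (i : ℕ) :
    (verschiebung x).ghost (i + 1) = algebraMap 𝒪 A π * x.ghost i := by
  rw [ghost, RamifiedWitt.ghost, Finset.sum_range_succ', ghost, RamifiedWitt.ghost,
    Finset.mul_sum, ext0_verschiebung_zero, zero_pow (pow_ne_zero _ resCard_pos), mul_zero,
    add_zero]
  refine Finset.sum_congr rfl fun j _ => ?_
  rw [ext0_verschiebung_succ, Nat.add_sub_add_right, pow_succ', mul_assoc]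

/-- The Witt vector of length one more with ghost components `(w₀, w₀ ^ q, …, w_m ^ q)`. -/
noncomputable def shiftPow (x : WittVec π m A) : WittVec π (m + 1) A :=
  trunc π (m + 1) fun i => MvPolynomial.aeval x.ext0 (shiftPoly π i)

theorem ghost_shiftPow_zero (x : WittVec π m A) : (shiftPow x).ghost 0 = x.ghost 0 := by
  rw [shiftPow, ghost_trunc _ (Nat.zero_le _), ghost_map, shiftPoly,
    (exists_shiftPoly π).choose_spec.1, ← ghost_map]
  simp [ghost]

theorem ghost_shiftPow_succ (x : WittVec π m A) {i : ℕ} (h : i ≤ m) :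
    (shiftPow x).ghost (i + 1) = x.ghost i ^ resCard π := by
  rw [shiftPow, ghost_trunc _ (Nat.succ_le_succ h), ghost_map, shiftPoly,
    (exists_shiftPoly π).choose_spec.2, map_pow, ← ghost_map]
  simp [ghost]

theorem mapFun_shiftPow (f : A →ₐ[𝒪] B) (x : WittVec π m A) :
    mapFun f (shiftPow x) = shiftPow (mapFun f x) := by
  ext i
  change f (MvPolynomial.aeval _ (shiftPoly π i)) = MvPolynomial.aeval _ (shiftPoly π i)
  rw [← AlgHom.comp_apply, MvPolynomial.comp_aeval]
  congr 2
  ext j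
  simp [ext0_mapFun]

/-- `(0, x) (0, y) = (0, π x y)` in Witt vectors of length two. -/
theorem verschiebung_mul_verschiebung (x y : WittVec π 0 A) :
    verschiebung x * verschiebung y =
      verschiebung ⟨fun _ => algebraMap 𝒪 A π * (x.coeff 0 * y.coeff 0)⟩ := by
  obtain ⟨x, rfl⟩ := exists_lift π 0 A x
  obtain ⟨y, rfl⟩ := exists_lift π 0 A y
  have h : verschiebung x * verschiebung y = verschiebung
      ⟨fun _ => algebraMap 𝒪 (MvPolynomial A 𝒪) π * (x.coeff 0 * y.coeff 0)⟩ :=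
    ghost_injective fun i hi => by
      rw [ghost_mul _ _ hi]
      obtain rfl | rfl : i = 0 ∨ i = 1 := by omega
      · simp only [ghost_verschiebung_zero, mul_zero]
      · simp only [ghost_verschiebung_succ _ 0, ghost_zero_eq]
        ring
  rw [← mapFun_verschiebung, ← mapFun_verschiebung, ← mapFun_mul, h, mapFun_verschiebung]
  congr 1
  ext i
  simp [mapFun]

/-- The product rule for V gives V(y)^(k+1) = V(π^k y^(k+1)), which vanishes once π^k = 0 in `A`. -/
theorem isNilpotent_of_coeff_zero_eq_zero (h : IsNilpotent (algebraMap 𝒪 A π))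
    (x : WittVec π 1 A) (hx : x.coeff 0 = 0) : IsNilpotent x := by
  obtain ⟨y, rfl⟩ := exists_verschiebung_eq x hx
  obtain ⟨k, hk⟩ := h
  have key : ∀ k, verschiebung y ^ (k + 1) =
      verschiebung ⟨fun _ => algebraMap 𝒪 A π ^ k * y.coeff 0 ^ (k + 1)⟩ := by
    intro k
    induction k with
    | zero =>
      refine (pow_one _).trans (congrArg verschiebung ?_)
      ext i
      rw [Fin.fin_one_eq_zero i]
      simp
    | succ k ih =>
      rw [pow_succ, ih, verschiebung_mul_verschiebung]
      congr 2
      funext i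
      ring
  refine ⟨k + 1, ?_⟩
  rw [key, hk]
  ext i
  refine Fin.cases ?_ (fun j => ?_) i
  · rfl
  · exact zero_mul _

end Shift

end WittVec

/-! ### The ring W_1(W_m(C)) as a fibre product. -/

section Iterated

variable {𝒪 : Type*} [CommRing 𝒪] {π : 𝒪} [IsDomain 𝒪] [hπ : Fact (Prime π)]
  [hfin : Finite (𝒪 ⧸ Ideal.span {π})] {R : Type u} [CommRing R] [Algebra 𝒪 R]
  [PiTorsionFree π R]

attribute [local instance] restrictAlgebra restrictAlgebra_tower

/-- The `R`-algebra `W_m(C)`. -/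
noncomputable def wittAlg (φ : FrobLift π R) (m : ℕ) (C : CommAlgCat.{u} R) : CommAlgCat.{u} R :=
  @CommAlgCat.of R _ (WittVec π m C) _ (WittVec.algebra φ m C)

variable (φ : FrobLift π R) (m : ℕ) {C D : CommAlgCat.{u} R}

/-- The ghost map `w_i : W_m(C) → C`, for `i ≤ m`. -/
noncomputable def wittAlgGhost (C : CommAlgCat.{u} R) {i : ℕ} (hi : i ≤ m) : wittAlg φ m C →+* C where
  toFun x := WittVec.ghost (π := π) (n := m) (A := C) x i
  map_one' := WittVec.ghost_one hi
  map_mul' _ _ := WittVec.ghost_mul _ _ hi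
  map_zero' := WittVec.ghost_zero hi
  map_add' _ _ := WittVec.ghost_add _ _ hi

/-- The ghost map w_i is only φ^i-semilinear over R. It still fixes π, because φ is 𝒪-linear. -/
theorem wittAlgGhost_algebraMap (C : CommAlgCat.{u} R) {i : ℕ} (hi : i ≤ m) (r : R) :
    wittAlgGhost φ m C hi (algebraMap R (wittAlg φ m C) r) = algebraMap R C (φ.φ^[i] r) := by
  change WittVec.ghost (π := π) (WittVec.mapFun _ (WittVec.exp φ m r)) i = _
  rw [WittVec.ghost_mapFun, WittVec.ghost_exp φ m r hi]
  rfl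

theorem wittAlgGhost_algebraMap_pi (C : CommAlgCat.{u} R) {i : ℕ} (hi : i ≤ m) :
    wittAlgGhost φ m C hi (algebraMap 𝒪 (wittAlg φ m C) π) = algebraMap 𝒪 C π := by
  change wittAlgGhost φ m C hi (algebraMap R (wittAlg φ m C) (algebraMap 𝒪 R π)) = _
  rw [wittAlgGhost_algebraMap, Function.iterate_fixed (φ.φ.commutes π) i]
  rfl

/-- The `R`-algebra homomorphism `W_m(f)`. -/
noncomputable def wittAlgMap (f : C →ₐ[R] D) : wittAlg φ m C →ₐ[R] wittAlg φ m D :=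
  AlgHom.mk (A := wittAlg φ m C) (B := wittAlg φ m D)
    (WittVec.map (π := π) (n := m) (f.restrictScalars 𝒪))
    fun _ => WittVec.ext (funext fun _ => f.commutes _)

/-- The map `W_1(W_m(C)) → W_{m+1}(C)` that sends ghost components
`(a₀, …, a_m)`, `(b₀, …, b_m)` to `(a₀, b₀, …, b_m)`. -/
noncomputable def contractFun (C : CommAlgCat.{u} R) (z : wittAlg φ 1 (wittAlg φ m C)) :
    WittVec π (m + 1) C :=
  WittVec.shiftPow (π := π) (m := m) (A := C) (WittVec.coeff (π := π) (n := 1) z 0) +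
    WittVec.verschiebung (π := π) (m := m) (A := C) (WittVec.coeff (π := π) (n := 1) z 1)

theorem ghost_contractFun_zero (z : wittAlg φ 1 (wittAlg φ m C)) :
    (contractFun φ m C z).ghost 0 = wittAlgGhost φ m C (Nat.zero_le m)
      (wittAlgGhost φ 1 (wittAlg φ m C) (Nat.zero_le 1) z) := by
  rw [contractFun, WittVec.ghost_add _ _ (Nat.zero_le _), WittVec.ghost_shiftPow_zero,
    WittVec.ghost_verschiebung_zero, add_zero]
  have e : wittAlgGhost φ 1 (wittAlg φ m C) (Nat.zero_le 1) z = _ :=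
    WittVec.ghost_zero_eq (π := π) (A := wittAlg φ m C) z
  rw [e]
  rfl

/-- With z = (x, y), the two summands contribute w_i(x)^q and π w_i(y). As w_i is a ring
homomorphism fixing π, their sum is w_i(x^q + π y), and x^q + π y is the ghost component w_1(z). -/
theorem ghost_contractFun_succ (z : wittAlg φ 1 (wittAlg φ m C)) {i : ℕ} (hi : i ≤ m) :
    (contractFun φ m C z).ghost (i + 1) =
      wittAlgGhost φ m C hi (wittAlgGhost φ 1 (wittAlg φ m C) le_rfl z) := by
  rw [contractFun, WittVec.ghost_add _ _ (Nat.succ_le_succ hi), WittVec.ghost_shiftPow_succ _ hi,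
    WittVec.ghost_verschiebung_succ]
  have e : wittAlgGhost φ 1 (wittAlg φ m C) le_rfl z = _ :=
    WittVec.ghost_one_eq (π := π) (A := wittAlg φ m C) z
  rw [e, map_add, map_pow, map_mul, wittAlgGhost_algebraMap_pi]
  rfl

theorem contractFun_map (f : C →ₐ[R] D) (z : wittAlg φ 1 (wittAlg φ m C)) :
    contractFun φ m D (wittAlgMap φ 1 (wittAlgMap φ m f) z) =
      WittVec.mapFun (f.restrictScalars 𝒪) (contractFun φ m C z) := by
  rw [contractFun, contractFun, WittVec.mapFun_add, WittVec.mapFun_shiftPow,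
    WittVec.mapFun_verschiebung]
  rfl

/-- The polynomial `R`-algebra on the elements of `C`. -/
noncomputable def freeAlg (C : CommAlgCat.{u} R) : CommAlgCat.{u} R :=
  CommAlgCat.of R (MvPolynomial C R)

/-- The evaluation map from the polynomial `R`-algebra on `C` to `C`. -/
noncomputable def freeAlgEval (C : CommAlgCat.{u} R) : freeAlg C →ₐ[R] C :=
  (MvPolynomial.aeval id : MvPolynomial C R →ₐ[R] C)

theorem freeAlgEval_surjective (C : CommAlgCat.{u} R) : Function.Surjective (freeAlgEval C) :=
  fun c => ⟨(MvPolynomial.X c : MvPolynomial C R), MvPolynomial.aeval_X _ _⟩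

/-- Torsion-freeness passes from R to polynomial rings over R, coefficient by coefficient. Every `C`
is thus a quotient of an R-algebra over which ghost components determine Witt vectors. -/
theorem piTorsionFree_freeAlg (C : CommAlgCat.{u} R) : PiTorsionFree π (freeAlg C) where
  eq_zero a h := by
    change MvPolynomial C R at a
    have h' : MvPolynomial.C (algebraMap 𝒪 R π) * a = 0 := h
    change a = 0
    ext s
    rw [MvPolynomial.coeff_zero]
    apply PiTorsionFree.eq_zero (π := π)
    rw [← MvPolynomial.coeff_C_mul, h', MvPolynomial.coeff_zero]

theorem wittAlgMap_surjective {f : C →ₐ[R] D} (hf : Function.Surjective f) :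
    Function.Surjective (wittAlgMap φ m f) :=
  WittVec.mapFun_surjective hf

theorem contractFun_eq_of_ghost [PiTorsionFree π C] {x : WittVec π (m + 1) C}
    {z : wittAlg φ 1 (wittAlg φ m C)}
    (h0 : wittAlgGhost φ m C (Nat.zero_le m)
      (wittAlgGhost φ 1 (wittAlg φ m C) (Nat.zero_le 1) z) = x.ghost 0)
    (h1 : ∀ (i : ℕ) (hi : i ≤ m), wittAlgGhost φ m C hi
      (wittAlgGhost φ 1 (wittAlg φ m C) le_rfl z) = x.ghost (i + 1)) :
    contractFun φ m C z = x := by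
  refine WittVec.ghost_injective fun i hi => ?_
  rcases i with _ | i
  · rw [ghost_contractFun_zero, h0]
  · rw [ghost_contractFun_succ φ m z (Nat.le_of_succ_le_succ hi), h1]

/-- The homomorphism `W_1(W_m(C)) → W_{m+1}(C)`. -/
noncomputable def contract (C : CommAlgCat.{u} R) :
    wittAlg φ 1 (wittAlg φ m C) →ₐ[R] wittAlg φ (m + 1) C := by
  -- All identities are lifted to the polynomial R-algebra on `C`, checked there on ghost
  -- components, and pushed down by naturality of `contractFun`.
  have hp := piTorsionFree_freeAlg (π := π) C
  have hs := wittAlgMap_surjective φ 1 (wittAlgMap_surjective φ m (freeAlgEval_surjective C))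
  have hadd : ∀ x y, contractFun φ m C (x + y) = contractFun φ m C x + contractFun φ m C y := by
    intro x y
    obtain ⟨x, rfl⟩ := hs x
    obtain ⟨y, rfl⟩ := hs y
    rw [← map_add, contractFun_map, contractFun_map, contractFun_map, ← WittVec.mapFun_add]
    congr 1
    refine contractFun_eq_of_ghost φ m ?_ fun i hi => ?_
    · rw [WittVec.ghost_add _ _ (Nat.zero_le _), ghost_contractFun_zero, ghost_contractFun_zero,
        map_add, map_add]
    · rw [WittVec.ghost_add _ _ (Nat.succ_le_succ hi), ghost_contractFun_succ φ m _ hi,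
        ghost_contractFun_succ φ m _ hi, map_add, map_add]
  have hmul : ∀ x y, contractFun φ m C (x * y) = contractFun φ m C x * contractFun φ m C y := by
    intro x y
    obtain ⟨x, rfl⟩ := hs x
    obtain ⟨y, rfl⟩ := hs y
    rw [← map_mul, contractFun_map, contractFun_map, contractFun_map, ← WittVec.mapFun_mul]
    congr 1
    refine contractFun_eq_of_ghost φ m ?_ fun i hi => ?_
    · rw [WittVec.ghost_mul _ _ (Nat.zero_le _), ghost_contractFun_zero, ghost_contractFun_zero,
        map_mul, map_mul]
    · rw [WittVec.ghost_mul _ _ (Nat.succ_le_succ hi), ghost_contractFun_succ φ m _ hi,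
        ghost_contractFun_succ φ m _ hi, map_mul, map_mul]
  -- Both sides have ghost components (r, φ r, …, φ^(m+1) r): the component w_i ∘ w_1 on the left is
  -- φ^i(φ r).
  have halg : ∀ r, contractFun φ m C (algebraMap R (wittAlg φ 1 (wittAlg φ m C)) r) =
      algebraMap R (wittAlg φ (m + 1) C) r := by
    intro r
    rw [← AlgHom.commutes (wittAlgMap φ 1 (wittAlgMap φ m (freeAlgEval C))),
      ← AlgHom.commutes (wittAlgMap φ (m + 1) (freeAlgEval C)), contractFun_map]
    refine congrArg (wittAlgMap φ (m + 1) (freeAlgEval C))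
      (contractFun_eq_of_ghost φ m (C := freeAlg C)
        (x := algebraMap R (wittAlg φ (m + 1) (freeAlg C)) r) ?_ fun i hi => ?_)
    · rw [wittAlgGhost_algebraMap, wittAlgGhost_algebraMap]
      exact (wittAlgGhost_algebraMap φ (m + 1) (freeAlg C) (Nat.zero_le _) r).symm
    · rw [wittAlgGhost_algebraMap, wittAlgGhost_algebraMap]
      exact (wittAlgGhost_algebraMap φ (m + 1) (freeAlg C) (Nat.succ_le_succ hi) r).symm
  exact AlgHom.mk (A := wittAlg φ 1 (wittAlg φ m C)) (B := wittAlg φ (m + 1) C)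
    { toFun := contractFun φ m C
      map_one' := by
        have h := halg 1
        rwa [map_one, map_one] at h
      map_zero' := by
        have h := halg 0
        rwa [map_zero, map_zero] at h
      map_add' := hadd
      map_mul' := hmul } halg

theorem coeff_zero_contractFun (z : wittAlg φ 1 (wittAlg φ m C)) :
    (contractFun φ m C z).coeff 0 = WittVec.coeff (π := π) (n := m) (A := C)
      (WittVec.coeff (π := π) (n := 1) z 0) 0 := by
  rw [← WittVec.ghost_zero_eq, ghost_contractFun_zero]
  have e : wittAlgGhost φ 1 (wittAlg φ m C) (Nat.zero_le 1) z = _ :=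
    WittVec.ghost_zero_eq (π := π) (A := wittAlg φ m C) z
  rw [e]
  exact WittVec.ghost_zero_eq (π := π) (m := m) (A := C) _

/-- `W_1(W_m(C))` is the fibre product of `W_{m+1}(C)` and `W_m(C)` over `C`. -/
theorem existsUnique_contractFun (w : WittVec π (m + 1) C) (s : WittVec π m C)
    (h : w.coeff 0 = s.coeff 0) : ∃! z : wittAlg φ 1 (wittAlg φ m C),
      contractFun φ m C z = w ∧ WittVec.coeff (π := π) (n := 1) z 0 = s := by
  -- The requirement z₀ = s forces V(z₁) = w - `shiftPow s`. This is solvable because the right side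
  -- has zeroth coordinate w₀ - s₀ = 0, and uniquely so because V is injective.
  have h0 : (w - WittVec.shiftPow s).coeff 0 = 0 := by
    rw [sub_eq_add_neg, ← WittVec.ghost_zero_eq, WittVec.ghost_add _ _ (Nat.zero_le _),
      WittVec.ghost_neg _ (Nat.zero_le _), WittVec.ghost_shiftPow_zero, WittVec.ghost_zero_eq,
      WittVec.ghost_zero_eq, h, add_neg_cancel]
  obtain ⟨x, hx⟩ := WittVec.exists_verschiebung_eq _ h0
  refine ⟨(⟨![s, x]⟩ : WittVec π 1 (WittVec π m C)), ⟨?_, rfl⟩, ?_⟩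
  · change WittVec.shiftPow s + WittVec.verschiebung x = w
    rw [hx, add_sub_cancel]
  · rintro z ⟨hz, hs⟩
    have hz' : WittVec.shiftPow (WittVec.coeff (π := π) (n := 1) (A := WittVec π m C) z 0) +
      WittVec.verschiebung (WittVec.coeff (π := π) (n := 1) (A := WittVec π m C) z 1) = w := hz
    have hs' : WittVec.coeff (π := π) (n := 1) (A := WittVec π m C) z 0 = s := hs
    rw [hs', ← eq_sub_iff_add_eq', ← hx] at hz'
    refine WittVec.ext (π := π) (n := 1) (A := WittVec π m C) (funext fun i => ?_)
    fin_cases i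
    · exact hs'
    · exact WittVec.verschiebung_injective hz'

end Iterated

/-! ## Formal schemes turn nil squares into fibre products -/

/-- The property of `l : A → A'` of being a localization at the powers of `f`. -/
structure IsAwayHom {R A A' : Type*} [CommRing R] [CommRing A] [CommRing A'] [Algebra R A]
    [Algebra R A'] (l : A →ₐ[R] A') (f : A) : Prop where
  isUnit : IsUnit (l f)
  surj : ∀ x, ∃ (k : ℕ) (y : A), x * l f ^ k = l y
  exists_pow_mul_eq_zero : ∀ y, l y = 0 → ∃ k : ℕ, f ^ k * y = 0

/-! ### Stability of fibre squares under localization. -/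

namespace IsAwayHom

variable {R P W S C P' W' S' C' : Type*} [CommRing R] [CommRing P] [CommRing W] [CommRing S]
  [CommRing C] [CommRing P'] [CommRing W'] [CommRing S'] [CommRing C'] [Algebra R P] [Algebra R W]
  [Algebra R S] [Algebra R C] [Algebra R P'] [Algebra R W'] [Algebra R S'] [Algebra R C']
  {a : P →ₐ[R] W} {b : P →ₐ[R] S} {c : W →ₐ[R] C} {d : S →ₐ[R] C}
  {a' : P' →ₐ[R] W'} {b' : P' →ₐ[R] S'} {c' : W' →ₐ[R] C'} {d' : S' →ₐ[R] C'}
  {lP : P →ₐ[R] P'} {lW : W →ₐ[R] W'} {lS : S →ₐ[R] S'} {lC : C →ₐ[R] C'} {f : P} {g : W}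

theorem exists_mul_eq (h : IsAwayHom lW g) (k : ℕ) (w : W) : ∃ x, x * lW g ^ k = lW w := by
  obtain ⟨u, hu⟩ := h.isUnit.pow k
  exact ⟨lW w * ↑u⁻¹, by rw [← hu, mul_assoc, Units.inv_mul, mul_one]⟩

theorem surjective (hW : IsAwayHom lW g) (hC : IsAwayHom lC (c g)) (hc : ∀ x, c' (lW x) = lC (c x))
    (h : Function.Surjective c) : Function.Surjective c' := fun y => by
  obtain ⟨k, y₀, hy⟩ := hC.surj y
  obtain ⟨w, rfl⟩ := h y₀
  obtain ⟨x, hx⟩ := hW.exists_mul_eq k w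
  refine ⟨x, ((hC.isUnit).pow k).mul_left_injective ?_⟩
  change c' x * lC (c g) ^ k = y * lC (c g) ^ k
  rw [hy, ← hc, ← hc, ← hx, map_mul, map_pow]

/-- Write w = w₀ / g^k. Some g^l w₀ already lies in the kernel before localization, so it is
nilpotent there, and g becomes a unit. -/
theorem isNilpotent (hW : IsAwayHom lW g) (hC : IsAwayHom lC (c g))
    (hc : ∀ x, c' (lW x) = lC (c x)) (h : ∀ w, c w = 0 → IsNilpotent w) (w : W') (hw : c' w = 0) :
    IsNilpotent w := by
  obtain ⟨k, w₀, hy⟩ := hW.surj w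
  obtain ⟨l, hl⟩ := hC.exists_pow_mul_eq_zero (c w₀) (by rw [← hc, ← hy, map_mul, hw, zero_mul])
  rw [← map_pow, ← map_mul] at hl
  obtain ⟨N, hN⟩ := (h _ hl).map lW
  rw [map_mul, map_pow, ← hy, mul_left_comm, ← pow_add, mul_pow] at hN
  exact ⟨N, ((hW.isUnit.pow _).pow N).mul_left_eq_zero.1 hN⟩

/-- Clear denominators: w = w₀ / f^k and s = s₀ / f^l have numerators f^l w₀ and f^k s₀ over
f^(k+l). A further factor f^j makes these agree in `C` itself, so they lift to some p in `P`, and p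
/ f^(j+k+l) is the required element. -/
theorem exists_eq (hP : IsAwayHom lP f) (hW : IsAwayHom lW (a f)) (hS : IsAwayHom lS (b f))
    (hC : IsAwayHom lC (c (a f))) (hcd : c (a f) = d (b f)) (ha : ∀ x, a' (lP x) = lW (a x))
    (hb : ∀ x, b' (lP x) = lS (b x)) (hc : ∀ x, c' (lW x) = lC (c x))
    (hd : ∀ x, d' (lS x) = lC (d x)) (h : ∀ w s, c w = d s → ∃ p, a p = w ∧ b p = s)
    (w : W') (s : S') (hws : c' w = d' s) : ∃ p, a' p = w ∧ b' p = s := by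
  obtain ⟨k, w₀, hw⟩ := hW.surj w
  obtain ⟨l, s₀, hs⟩ := hS.surj s
  have h1 : lC (c (w₀ * a f ^ l) - d (s₀ * b f ^ k)) = 0 := by
    rw [map_sub, ← hc, ← hd, map_mul lW, map_mul lS, ← hw, ← hs, map_mul, map_mul, map_mul, map_mul,
      hws, map_pow, map_pow, map_pow, map_pow, map_pow, map_pow, hc, hd, hcd]
    ring
  obtain ⟨j, hj⟩ := hC.exists_pow_mul_eq_zero _ h1
  obtain ⟨p, hpa, hpb⟩ := h (a f ^ j * (w₀ * a f ^ l)) (b f ^ j * (s₀ * b f ^ k)) (by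
    rw [map_mul c, map_mul d, map_pow c, map_pow d, ← hcd]
    linear_combination hj)
  obtain ⟨p', hp'⟩ := hP.exists_mul_eq (j + k + l) p
  refine ⟨p', (hW.isUnit.pow (j + k + l)).mul_left_injective ?_,
    (hS.isUnit.pow (j + k + l)).mul_left_injective ?_⟩
  · change a' p' * lW (a f) ^ (j + k + l) = w * lW (a f) ^ (j + k + l)
    rw [← ha, ← map_pow, ← map_mul, hp', ha, hpa, map_mul, map_mul, ← hw, map_pow, map_pow, map_pow,
      ha]
    ring
  · change b' p' * lS (b f) ^ (j + k + l) = s * lS (b f) ^ (j + k + l)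
    rw [← hb, ← map_pow, ← map_mul, hp', hb, hpb, map_mul, map_mul, ← hs, map_pow, map_pow, map_pow,
      hb]
    ring

theorem eq_zero (hP : IsAwayHom lP f) (hW : IsAwayHom lW (a f)) (hS : IsAwayHom lS (b f))
    (ha : ∀ x, a' (lP x) = lW (a x)) (hb : ∀ x, b' (lP x) = lS (b x))
    (h : ∀ p, a p = 0 → b p = 0 → p = 0) (p : P') (hpa : a' p = 0) (hpb : b' p = 0) : p = 0 := by
  obtain ⟨k, p₀, hp⟩ := hP.surj p
  obtain ⟨i, hi⟩ := hW.exists_pow_mul_eq_zero (a p₀) (by rw [← ha, ← hp, map_mul, hpa, zero_mul])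
  obtain ⟨j, hj⟩ := hS.exists_pow_mul_eq_zero (b p₀) (by rw [← hb, ← hp, map_mul, hpb, zero_mul])
  have h3 : f ^ (i + j) * p₀ = 0 := by
    refine h _ ?_ ?_
    · rw [map_mul, map_pow, pow_add, mul_right_comm, hi, zero_mul]
    · rw [map_mul, map_pow, pow_add, mul_assoc, hj, mul_zero]
  have h4 := congrArg lP h3
  rw [map_mul, map_zero, map_pow, ← hp, mul_left_comm, ← pow_add] at h4
  exact (hP.isUnit.pow _).mul_left_eq_zero.1 h4

end IsAwayHom

/-! ### Nil squares and localization in `Nilp`. -/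

section Squares

variable {R : Type u} [CommRing R] {ϖ : R}

/-- A cartesian square in `Nilp ϖ` in which `W → C` is surjective with nil kernel. -/
structure IsNilSquare {P W S C : Nilp ϖ} (a : P ⟶ W) (b : P ⟶ S) (c : W ⟶ C) (d : S ⟶ C) :
    Prop where
  comm : a ≫ c = b ≫ d
  surjective : Function.Surjective c.hom.hom
  isNilpotent : ∀ w, c.hom.hom w = 0 → IsNilpotent w
  exists_eq : ∀ w s, c.hom.hom w = d.hom.hom s → ∃ p, a.hom.hom p = w ∧ b.hom.hom p = s
  eq_zero : ∀ p, a.hom.hom p = 0 → b.hom.hom p = 0 → p = 0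

/-- Some j in J maps to 1. Then 1 - j is nilpotent, so j is a unit. Geometrically, a nil thickening
does not change the underlying space. -/
theorem Ideal.eq_top_of_map_eq_top {A B : Type*} [CommRing A] [CommRing B] {f : A →+* B}
    (hf : Function.Surjective f) (hn : ∀ a, f a = 0 → IsNilpotent a) {J : Ideal A}
    (h : J.map f = ⊤) : J = ⊤ := by
  obtain ⟨j, hj, e⟩ := (Ideal.mem_map_iff_of_surjective f hf).1 ((Ideal.eq_top_iff_one _).1 h)
  refine Ideal.eq_top_of_isUnit_mem J hj ?_
  have := (hn (1 - j) (by rw [map_sub, e, map_one, sub_self])).isUnit_one_sub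
  rwa [sub_sub_cancel] at this

namespace Nilp

theorem comp_apply {A B C : Nilp ϖ} (f : A ⟶ B) (g : B ⟶ C) (x : A.obj) :
    (f ≫ g).hom.hom x = g.hom.hom (f.hom.hom x) := rfl

theorem hom_ext {A B : Nilp ϖ} {f g : A ⟶ B} (h : ∀ x, f.hom.hom x = g.hom.hom x) : f = g := by
  apply ObjectProperty.hom_ext
  apply CommAlgCat.hom_ext
  exact AlgHom.ext h

theorem isUnit_toAway (C : Nilp ϖ) (f : C.obj) : IsUnit ((C.toAway f).hom.hom f) :=
  IsLocalization.Away.algebraMap_isUnit (S := Localization.Away f) f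

theorem isAwayHom (C : Nilp ϖ) (f : C.obj) : IsAwayHom (C.toAway f).hom.hom f where
  isUnit := C.isUnit_toAway f
  surj x := IsLocalization.Away.surj (S := Localization.Away f) f x
  exists_pow_mul_eq_zero y h := by
    obtain ⟨k, hk⟩ := IsLocalization.Away.exists_of_eq (S := Localization.Away f) f
      (a := y) (b := 0) (h.trans (map_zero (algebraMap C.obj (Localization.Away f))).symm)
    exact ⟨k, by rw [hk, mul_zero]⟩

/-- The universal property of `C[1/f]`. -/
noncomputable def awayLift {C D : Nilp ϖ} (f : C.obj) (g : C ⟶ D) (h : IsUnit (g.hom.hom f)) :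
    C.away f ⟶ D :=
  ObjectProperty.homMk (CommAlgCat.ofHom
    (IsLocalization.Away.liftAlgHom (S := Localization.Away f) (A := R) f (f := g.hom.hom) h))

theorem toAway_awayLift {C D : Nilp ϖ} (f : C.obj) (g : C ⟶ D) (h : IsUnit (g.hom.hom f)) :
    C.toAway f ≫ awayLift f g h = g :=
  hom_ext fun x => IsLocalization.Away.lift_eq (S := Localization.Away f) f h x

theorem awayLift_toAway_apply {C D : Nilp ϖ} (f : C.obj) (g : C ⟶ D) (h : IsUnit (g.hom.hom f))
    (x : C.obj) : (awayLift f g h).hom.hom ((C.toAway f).hom.hom x) = g.hom.hom x :=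
  IsLocalization.Away.lift_eq (S := Localization.Away f) f h x

theorem away_hom_ext {C D : Nilp ϖ} {f : C.obj} {g h : C.away f ⟶ D}
    (e : C.toAway f ≫ g = C.toAway f ≫ h) : g = h := by
  refine hom_ext fun x => ?_
  have key : ∀ y, g.hom.hom ((C.toAway f).hom.hom y) = h.hom.hom ((C.toAway f).hom.hom y) :=
    fun y => by rw [← comp_apply, ← comp_apply, e]
  obtain ⟨k, y, hy⟩ := (C.isAwayHom f).surj x
  have hu : IsUnit (g.hom.hom ((C.toAway f).hom.hom f ^ k)) :=
    ((C.isUnit_toAway f).pow k).map _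
  rw [← hu.mul_left_inj, ← map_mul, hy, key, ← hy, map_mul, map_pow, map_pow, key]

/-- The map `C[1/f] → D[1/h]` induced by `g : C → D`, when `g f = h`. -/
noncomputable def awayMap {C D : Nilp ϖ} (g : C ⟶ D) (f : C.obj) (h : D.obj)
    (e : g.hom.hom f = h) : C.away f ⟶ D.away h :=
  awayLift f (g ≫ D.toAway h) (by rw [comp_apply, e]; exact D.isUnit_toAway h)

theorem toAway_awayMap {C D : Nilp ϖ} (g : C ⟶ D) (f : C.obj) (h : D.obj)
    (e : g.hom.hom f = h) : C.toAway f ≫ awayMap g f h e = g ≫ D.toAway h :=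
  toAway_awayLift _ _ _

theorem awayMap_toAway_apply {C D : Nilp ϖ} (g : C ⟶ D) (f : C.obj) (h : D.obj)
    (e : g.hom.hom f = h) (x : C.obj) : (awayMap g f h e).hom.hom ((C.toAway f).hom.hom x) =
      (D.toAway h).hom.hom (g.hom.hom x) :=
  awayLift_toAway_apply _ _ _ _

end Nilp

namespace IsNilSquare

variable {P W S C : Nilp ϖ} {a : P ⟶ W} {b : P ⟶ S} {c : W ⟶ C} {d : S ⟶ C}

theorem comm_apply (h : IsNilSquare a b c d) (p : P.obj) :
    c.hom.hom (a.hom.hom p) = d.hom.hom (b.hom.hom p) := by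
  rw [← Nilp.comp_apply, h.comm, Nilp.comp_apply]

theorem surjective_right (h : IsNilSquare a b c d) : Function.Surjective b.hom.hom := fun s => by
  obtain ⟨w, hw⟩ := h.surjective (d.hom.hom s)
  obtain ⟨p, -, hp⟩ := h.exists_eq w s hw
  exact ⟨p, hp⟩

theorem isNilpotent_right (h : IsNilSquare a b c d) (p : P.obj) (hp : b.hom.hom p = 0) :
    IsNilpotent p := by
  obtain ⟨k, hk⟩ := h.isNilpotent (a.hom.hom p) (by rw [h.comm_apply, hp, map_zero])
  -- The exponent k + 1 rather than k ensures that 0 raised to it is 0 on the `S` side, even when k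
  -- = 0.
  refine ⟨k + 1, h.eq_zero _ ?_ ?_⟩
  · rw [map_pow, pow_succ, hk, zero_mul]
  · rw [map_pow, hp, zero_pow (Nat.succ_ne_zero k)]

theorem eq_of_eq (h : IsNilSquare a b c d) {p p' : P.obj} (ha : a.hom.hom p = a.hom.hom p')
    (hb : b.hom.hom p = b.hom.hom p') : p = p' :=
  sub_eq_zero.1 (h.eq_zero _ (by rw [map_sub, ha, sub_self]) (by rw [map_sub, hb, sub_self]))

/-- Nil squares are stable under localization. -/
theorem away (h : IsNilSquare a b c d) (f : P.obj) :
    IsNilSquare (Nilp.awayMap a f _ rfl) (Nilp.awayMap b f _ rfl)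
      (Nilp.awayMap c (a.hom.hom f) _ rfl)
      (Nilp.awayMap d (b.hom.hom f) (c.hom.hom (a.hom.hom f)) (h.comm_apply f).symm) where
  comm := by
    apply Nilp.away_hom_ext
    rw [← Category.assoc, ← Category.assoc, Nilp.toAway_awayMap, Nilp.toAway_awayMap,
      Category.assoc, Category.assoc, Nilp.toAway_awayMap, Nilp.toAway_awayMap, ← Category.assoc,
      h.comm, Category.assoc]
  surjective := (W.isAwayHom _).surjective (C.isAwayHom _) (Nilp.awayMap_toAway_apply _ _ _ _)
    h.surjective
  isNilpotent := (W.isAwayHom _).isNilpotent (C.isAwayHom _) (Nilp.awayMap_toAway_apply _ _ _ _)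
    h.isNilpotent
  exists_eq := (P.isAwayHom f).exists_eq (W.isAwayHom _) (S.isAwayHom _) (C.isAwayHom _)
    (h.comm_apply f) (Nilp.awayMap_toAway_apply _ _ _ _) (Nilp.awayMap_toAway_apply _ _ _ _)
    (Nilp.awayMap_toAway_apply _ _ _ _) (Nilp.awayMap_toAway_apply _ _ _ _) h.exists_eq
  eq_zero := (P.isAwayHom f).eq_zero (W.isAwayHom _) (S.isAwayHom _)
    (Nilp.awayMap_toAway_apply _ _ _ _) (Nilp.awayMap_toAway_apply _ _ _ _) h.eq_zero

/-- The fibre product property for algebra homomorphisms. -/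
theorem exists_algHom (h : IsNilSquare a b c d) {A : Type*} [CommRing A] [Algebra R A]
    (f : A →ₐ[R] W.obj) (g : A →ₐ[R] S.obj) (e : ∀ t, c.hom.hom (f t) = d.hom.hom (g t)) :
    ∃ k : A →ₐ[R] P.obj, a.hom.hom.comp k = f ∧ b.hom.hom.comp k = g := by
  choose k hk using fun t => h.exists_eq (f t) (g t) (e t)
  refine ⟨{ toFun := k
            map_one' := h.eq_of_eq ?_ ?_
            map_mul' := fun x y => h.eq_of_eq ?_ ?_
            map_zero' := h.eq_of_eq ?_ ?_
            map_add' := fun x y => h.eq_of_eq ?_ ?_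
            commutes' := fun r => h.eq_of_eq ?_ ?_ },
    AlgHom.ext fun t => (hk t).1, AlgHom.ext fun t => (hk t).2⟩
  all_goals simp [(hk _).1, (hk _).2]

end IsNilSquare

/-! ### Fibre products, from formal spectra to formal schemes. -/

variable {F : Nilp ϖ ⥤ Type u}

theorem map_comp_apply (F : Nilp ϖ ⥤ Type u) {A B C : Nilp ϖ} (f : A ⟶ B) (g : B ⟶ C)
    (x : F.obj A) : F.map (f ≫ g) x = F.map g (F.map f x) := by
  rw [F.map_comp]
  rfl

/-- The fibre product property of a formal spectrum. -/
theorem IsNilSquare.existsUnique_spf {P W S C : Nilp ϖ} {a : P ⟶ W} {b : P ⟶ S} {c : W ⟶ C}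
    {d : S ⟶ C} (h : IsNilSquare a b c d) (hF : IsFormalAffine F) (x : F.obj W) (y : F.obj S)
    (hxy : F.map c x = F.map d y) : ∃! z, F.map a z = x ∧ F.map b z = y := by
  obtain ⟨A, I, -, -, ⟨e⟩⟩ := hF
  have hinj : ∀ (D : Nilp ϖ) (z z' : F.obj D), e.hom.app D z = e.hom.app D z' → z = z' := by
    intro D z z' hz
    have := congrArg (e.inv.app D) hz
    simpa using this
  have hnat : ∀ {D E : Nilp ϖ} (g : D ⟶ E) (z : F.obj D),
      (e.hom.app E (F.map g z)).1 = g.hom.hom.comp (e.hom.app D z).1 := by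
    intro D E g z
    have := ConcreteCategory.congr_hom (e.hom.naturality g) z
    exact congrArg Subtype.val this
  obtain ⟨k, hka, hkb⟩ := h.exists_algHom (e.hom.app W x).1 (e.hom.app S y).1 fun t => by
    have := congrArg (fun z => (e.hom.app C z).1 t) hxy
    simp only [hnat] at this
    exact this
  obtain ⟨i, hi⟩ := (e.hom.app W x).2
  obtain ⟨j, hj⟩ := (e.hom.app S y).2
  -- Continuity: if I^i dies in `W` and I^j in `S`, then I^(i+j) dies in both, hence in the fibre
  -- product `P`.
  have hk : ∃ l : ℕ, I ^ l ≤ RingHom.ker k := by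
    refine ⟨i + j, fun t ht => h.eq_zero _ ?_ ?_⟩
    · have : (e.hom.app W x).1 t = 0 := hi (Ideal.pow_le_pow_right (Nat.le_add_right i j) ht)
      rwa [← hka] at this
    · have : (e.hom.app S y).1 t = 0 := hj (Ideal.pow_le_pow_right (Nat.le_add_left j i) ht)
      rwa [← hkb] at this
  have hz : e.hom.app P (e.inv.app P (⟨k, hk⟩ : (Spf ϖ A I).obj P)) =
      (⟨k, hk⟩ : (Spf ϖ A I).obj P) := ConcreteCategory.congr_hom (e.inv_hom_id_app P) _
  refine ⟨e.inv.app P (⟨k, hk⟩ : (Spf ϖ A I).obj P), ⟨?_, ?_⟩, ?_⟩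
  · refine hinj _ _ _ (Subtype.ext ?_)
    rw [hnat, hz, ← hka]
  · refine hinj _ _ _ (Subtype.ext ?_)
    rw [hnat, hz, ← hkb]
  · rintro z ⟨rfl, rfl⟩
    refine hinj _ _ _ (Subtype.ext ?_)
    rw [hz]
    rw [hnat] at hka hkb
    refine AlgHom.ext fun t => h.eq_of_eq ?_ ?_
    · exact (DFunLike.congr_fun hka t).symm
    · exact (DFunLike.congr_fun hkb t).symm

/-- The locus of x in U is the complement of some V(J). If J generates the unit ideal modulo a nil
ideal, it is already the unit ideal, so the locus is everything. -/
theorem IsOpenSubfunctor.mem_of_map_mem {U : Subfunctor F} (hU : IsOpenSubfunctor U)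
    {A B : Nilp ϖ} {f : A ⟶ B} (hf : Function.Surjective f.hom.hom)
    (hn : ∀ x, f.hom.hom x = 0 → IsNilpotent x) {x : F.obj A} (hx : F.map f x ∈ U.obj B) :
    x ∈ U.obj A := by
  obtain ⟨J, hJ⟩ := hU A x
  have h := Ideal.eq_top_of_map_eq_top (f := (f.hom.hom : A.obj →+* B.obj)) hf hn ((hJ B f).1 hx)
  have h2 := (hJ A (𝟙 A)).2 (by rw [h, Ideal.map_top])
  simpa using h2

/-- The fibre product property of an open formal affine subfunctor. -/
theorem IsNilSquare.existsUnique_of_mem {P W S C : Nilp ϖ} {a : P ⟶ W} {b : P ⟶ S} {c : W ⟶ C}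
    {d : S ⟶ C} (h : IsNilSquare a b c d) {U : Subfunctor F} (hU : IsOpenSubfunctor U)
    (hF : IsFormalAffine U.toFunctor) (x : F.obj W) (y : F.obj S)
    (hxy : F.map c x = F.map d y) (hy : y ∈ U.obj S) : ∃! z, F.map a z = x ∧ F.map b z = y := by
  -- The common image of x and y in F(C) lies in U because y does, and membership lifts along the
  -- nil thickening W → C.
  have hx : x ∈ U.obj W := hU.mem_of_map_mem h.surjective h.isNilpotent (by
    rw [hxy]
    exact U.map d hy)
  obtain ⟨z, ⟨hza, hzb⟩, hz⟩ := h.existsUnique_spf hF (⟨x, hx⟩ : U.toFunctor.obj W)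
    (⟨y, hy⟩ : U.toFunctor.obj S) (Subtype.ext hxy)
  refine ⟨z.1, ⟨congrArg Subtype.val hza, congrArg Subtype.val hzb⟩, ?_⟩
  rintro z' ⟨hza', hzb'⟩
  -- Any competing solution also lies in U, since P → S is a nil thickening too; uniqueness inside U
  -- therefore suffices.
  have hz' : z' ∈ U.obj P := hU.mem_of_map_mem h.surjective_right h.isNilpotent_right (by
    rw [hzb']
    exact hy)
  exact congrArg Subtype.val (hz ⟨z', hz'⟩ ⟨Subtype.ext hza', Subtype.ext hzb'⟩)

theorem IsZariskiSheaf.eq_of_map_toAway_eq (hF : IsZariskiSheaf F) {C : Nilp ϖ} {s : Set C.obj}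
    (hs : Ideal.span s = ⊤) {x y : F.obj C}
    (h : ∀ f ∈ s, F.map (C.toAway f) x = F.map (C.toAway f) y) : x = y := by
  obtain ⟨z, -, hz⟩ := hF C s hs (fun f => F.map (C.toAway f.1) y) (by
    intro f g D a b e
    rw [← map_comp_apply, ← map_comp_apply, e])
  exact (hz x fun f => h f.1 f.2).trans (hz y fun f => rfl).symm

/-- Formal schemes turn nil squares into fibre products. -/
theorem IsNilSquare.existsUnique {P W S C : Nilp ϖ} {a : P ⟶ W} {b : P ⟶ S} {c : W ⟶ C}
    {d : S ⟶ C} (h : IsNilSquare a b c d) (hF : IsFormalScheme F) (x : F.obj W) (y : F.obj S)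
    (hxy : F.map c x = F.map d y) : ∃! z, F.map a z = x ∧ F.map b z = y := by
  obtain ⟨hsheaf, 𝒰, h𝒰, hcov⟩ := hF
  obtain ⟨s, hs, hsU⟩ := hcov S y
  -- Those f for which y, restricted to S[1/b(f)], lies in a single member of the cover. They
  -- generate the unit ideal because their images in `S` do and P → S is surjective with nil kernel.
  set t : Set P.obj := {f | ∃ U ∈ 𝒰, F.map (S.toAway (b.hom.hom f)) y ∈ U.obj _} with ht
  have hspan : Ideal.span t = ⊤ := by
    refine Ideal.eq_top_of_map_eq_top (f := (b.hom.hom : P.obj →+* S.obj)) h.surjective_right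
      h.isNilpotent_right ?_
    rw [eq_top_iff, ← hs, Ideal.map_span]
    refine Ideal.span_mono fun g hg => ?_
    obtain ⟨f, rfl⟩ := h.surjective_right g
    exact ⟨f, hsU _ hg, rfl⟩
  have hloc : ∀ f ∈ t, ∃! z, F.map (Nilp.awayMap a f _ rfl) z = F.map (W.toAway _) x ∧
      F.map (Nilp.awayMap b f _ rfl) z = F.map (S.toAway _) y := by
    rintro f ⟨U, hU, hyU⟩
    refine (h.away f).existsUnique_of_mem (h𝒰 U hU).1 (h𝒰 U hU).2 _ _ ?_ hyU
    rw [← map_comp_apply, ← map_comp_apply, Nilp.toAway_awayMap, Nilp.toAway_awayMap,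
      map_comp_apply, map_comp_apply, hxy]
  -- Needed so that uniqueness of local solutions is also available over the overlaps P[1/(fg)].
  have hmul : ∀ f ∈ t, ∀ g, f * g ∈ t := by
    rintro f ⟨U, hU, hyU⟩ g
    refine ⟨U, hU, ?_⟩
    have hu : IsUnit ((S.toAway (b.hom.hom (f * g))).hom.hom (b.hom.hom f)) := by
      have := S.isUnit_toAway (b.hom.hom (f * g))
      rw [map_mul b.hom.hom, map_mul] at this
      rw [map_mul b.hom.hom]
      exact isUnit_of_mul_isUnit_left this
    have := U.map (Nilp.awayLift (b.hom.hom f) (S.toAway (b.hom.hom (f * g))) hu) hyU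
    rwa [Set.mem_preimage, ← map_comp_apply, Nilp.toAway_awayLift] at this
  choose ζ hζ using fun f : t => (hloc f.1 f.2).exists
  -- The restrictions of ζ_f and ζ_g to P[1/(fg)] solve the same fibre product problem, so they
  -- coincide. Both f and g become units in any `D` receiving compatible maps, so these maps factor
  -- through P[1/(fg)].
  obtain ⟨z, hz, -⟩ := hsheaf P t hspan ζ (by
    rintro ⟨f, hf⟩ ⟨g, hg⟩ D α β hαβ
    have hres : ∀ (k) (hk : k ∈ t) (hu : IsUnit ((P.toAway (f * g)).hom.hom k)),
        F.map (Nilp.awayMap a (f * g) _ rfl)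
            (F.map (Nilp.awayLift k (P.toAway (f * g)) hu) (ζ ⟨k, hk⟩)) = F.map (W.toAway _) x ∧
          F.map (Nilp.awayMap b (f * g) _ rfl)
            (F.map (Nilp.awayLift k (P.toAway (f * g)) hu) (ζ ⟨k, hk⟩)) = F.map (S.toAway _) y := by
      intro k hk hu
      have hua : IsUnit ((W.toAway (a.hom.hom (f * g))).hom.hom (a.hom.hom k)) := by
        rw [← Nilp.awayMap_toAway_apply a _ _ rfl]
        exact hu.map _
      have hub : IsUnit ((S.toAway (b.hom.hom (f * g))).hom.hom (b.hom.hom k)) := by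
        rw [← Nilp.awayMap_toAway_apply b _ _ rfl]
        exact hu.map _
      have ea : Nilp.awayLift k (P.toAway (f * g)) hu ≫ Nilp.awayMap a (f * g) _ rfl =
          Nilp.awayMap a k _ rfl ≫ Nilp.awayLift _ (W.toAway (a.hom.hom (f * g))) hua := by
        apply Nilp.away_hom_ext
        rw [← Category.assoc, ← Category.assoc, Nilp.toAway_awayLift, Nilp.toAway_awayMap,
          Nilp.toAway_awayMap, Category.assoc, Nilp.toAway_awayLift]
      have eb : Nilp.awayLift k (P.toAway (f * g)) hu ≫ Nilp.awayMap b (f * g) _ rfl =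
          Nilp.awayMap b k _ rfl ≫ Nilp.awayLift _ (S.toAway (b.hom.hom (f * g))) hub := by
        apply Nilp.away_hom_ext
        rw [← Category.assoc, ← Category.assoc, Nilp.toAway_awayLift, Nilp.toAway_awayMap,
          Nilp.toAway_awayMap, Category.assoc, Nilp.toAway_awayLift]
      rw [← map_comp_apply, ← map_comp_apply, ea, eb, map_comp_apply, map_comp_apply,
        (hζ ⟨k, hk⟩).1, (hζ ⟨k, hk⟩).2, ← map_comp_apply, ← map_comp_apply, Nilp.toAway_awayLift,
        Nilp.toAway_awayLift]
      exact ⟨rfl, rfl⟩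
    have hu := P.isUnit_toAway (f * g)
    rw [map_mul] at hu
    have huf := isUnit_of_mul_isUnit_left hu
    have hug := isUnit_of_mul_isUnit_right hu
    have key := (hloc _ (hmul f hf g)).unique (hres f hf huf) (hres g hg hug)
    have huD : IsUnit ((P.toAway f ≫ α).hom.hom (f * g)) := by
      rw [map_mul]
      refine IsUnit.mul ?_ ?_
      · exact (P.isUnit_toAway f).map α.hom.hom
      · rw [hαβ]
        exact (P.isUnit_toAway g).map β.hom.hom
    have eα : α = Nilp.awayLift f (P.toAway (f * g)) huf ≫ Nilp.awayLift _ _ huD := by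
      apply Nilp.away_hom_ext
      rw [← Category.assoc, Nilp.toAway_awayLift, Nilp.toAway_awayLift]
    have eβ : β = Nilp.awayLift g (P.toAway (f * g)) hug ≫ Nilp.awayLift _ _ huD := by
      apply Nilp.away_hom_ext
      rw [← Category.assoc, Nilp.toAway_awayLift, Nilp.toAway_awayLift, hαβ]
    change F.map α (ζ ⟨f, hf⟩) = F.map β (ζ ⟨g, hg⟩)
    rw [eα, eβ, map_comp_apply, map_comp_apply, key])
  -- The images of t still cover `W` and `S`, so the equations for z can be checked locally there.
  have hspan_map : ∀ {Q : Nilp ϖ} (g : P ⟶ Q), Ideal.span (g.hom.hom '' t) = ⊤ := by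
    intro Q g
    have := Ideal.map_span (g.hom.hom : P.obj →+* Q.obj) t
    rw [hspan, Ideal.map_top] at this
    exact this.symm
  refine ⟨z, ⟨?_, ?_⟩, ?_⟩
  · refine hsheaf.eq_of_map_toAway_eq (hspan_map a) ?_
    rintro _ ⟨f, hf, rfl⟩
    rw [← map_comp_apply, ← Nilp.toAway_awayMap a f _ rfl, map_comp_apply, hz ⟨f, hf⟩, (hζ ⟨f, hf⟩).1]
  · refine hsheaf.eq_of_map_toAway_eq (hspan_map b) ?_
    rintro _ ⟨f, hf, rfl⟩
    rw [← map_comp_apply, ← Nilp.toAway_awayMap b f _ rfl, map_comp_apply, hz ⟨f, hf⟩, (hζ ⟨f, hf⟩).2]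
  · rintro z' ⟨hza, hzb⟩
    refine hsheaf.eq_of_map_toAway_eq hspan fun f hf => ?_
    rw [hz ⟨f, hf⟩]
    refine (hloc f hf).unique ⟨?_, ?_⟩ (hζ ⟨f, hf⟩)
    · rw [← map_comp_apply, Nilp.toAway_awayMap, map_comp_apply, hza]
    · rw [← map_comp_apply, Nilp.toAway_awayMap, map_comp_apply, hzb]

end Squares

/-! ## Kernels of jets -/

section Assembly

variable {𝒪 : Type*} [CommRing 𝒪] {π : 𝒪} [IsDomain 𝒪] [hπ : Fact (Prime π)]
  [hfin : Finite (𝒪 ⧸ Ideal.span {π})] {R : Type u} [CommRing R] [Algebra 𝒪 R]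
  [PiTorsionFree π R]

attribute [local instance] restrictAlgebra restrictAlgebra_tower

variable (φ : FrobLift π R) (m : ℕ)

/-- The natural homomorphism `W_1(W_m(C)) → W_{m+1}(C)`, in `Nilp`. -/
noncomputable def contractHom (C : Nilp (algebraMap 𝒪 R π)) :
    (wittFunctor φ 1).obj ((wittFunctor φ m).obj C) ⟶ (wittFunctor φ (m + 1)).obj C :=
  ObjectProperty.homMk (ConcreteCategory.ofHom (C := CommAlgCat R)
    (X := (wittObj φ 1 (wittObj φ m C)).obj) (Y := (wittObj φ (m + 1) C).obj) (contract φ m C.obj))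

theorem contractHom_naturality {C D : Nilp (algebraMap 𝒪 R π)} (f : C ⟶ D) :
    (wittFunctor φ 1).map ((wittFunctor φ m).map f) ≫ contractHom φ m D =
      contractHom φ m C ≫ (wittFunctor φ (m + 1)).map f :=
  Nilp.hom_ext fun z => contractFun_map φ m f.hom.hom z

theorem isNilSquare_contractHom (C : Nilp (algebraMap 𝒪 R π)) :
    IsNilSquare (contractHom φ m C) ((wittProj φ 1).app ((wittFunctor φ m).obj C))
      ((wittProj φ (m + 1)).app C) ((wittProj φ m).app C) where
  comm := Nilp.hom_ext fun z => coeff_zero_contractFun φ m z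
  surjective c := ⟨(⟨fun _ => c⟩ : WittVec π (m + 1) C.obj), rfl⟩
  isNilpotent w hw := by
    -- The fibre product with s = 0 exhibits w as the image of a length-two vector over W_m(C) with
    -- zeroth coordinate 0. Such a vector is nilpotent because π is nilpotent in W_m(C).
    obtain ⟨z, ⟨rfl, hz⟩, -⟩ := existsUnique_contractFun φ m (C := C.obj) w 0 hw
    refine (WittVec.isNilpotent_of_coeff_zero_eq_zero (A := wittAlg φ m C.obj)
      ?_ z hz).map (contract φ m C.obj)
    exact WittVec.isNilpotent φ m C.property
  exists_eq w s h := (existsUnique_contractFun φ m (C := C.obj) w s h).exists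
  eq_zero z h1 h2 := (existsUnique_contractFun φ m (C := C.obj) 0 0 rfl).unique ⟨h1, h2⟩
    ⟨map_zero (contract φ m C.obj), rfl⟩

/-- The homomorphism `J^m (N^1 G) → N^{m+1} G`. -/
noncomputable def jetJetKernelHom (G : Nilp (algebraMap 𝒪 R π) ⥤ GrpCat.{u})
    (C : Nilp (algebraMap 𝒪 R π)) :
    (jet φ m (jetKernel φ 1 G)).obj C →* (jetKernel φ (m + 1) G).obj C :=
  ((G.map (contractHom φ m C)).hom.comp
    (G.map ((wittProj φ 1).app ((wittFunctor φ m).obj C))).hom.ker.subtype).codRestrict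
      (G.map ((wittProj φ (m + 1)).app C)).hom.ker fun x => by
    have h : G.map ((wittProj φ 1).app ((wittFunctor φ m).obj C)) x.1 = 1 := x.2
    have e := congrArg (fun g => G.map g x.1) (isNilSquare_contractHom φ m C).comm
    simp only [G.map_comp] at e
    change G.map ((wittProj φ (m + 1)).app C) (G.map (contractHom φ m C) x.1) = 1
    refine e.trans ?_
    exact (congrArg (G.map ((wittProj φ m).app C)) h).trans
      (map_one (G.map ((wittProj φ m).app C)).hom)

/-- An element x of N^{m+1} G(C) and the identity of G(W_m(C)) both lie over 1 in G(C). The unique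
point of G(W_1(W_m(C))) over this pair is the unique preimage of x in the kernel. -/
theorem jetJetKernelHom_bijective (G : Nilp (algebraMap 𝒪 R π) ⥤ GrpCat.{u})
    (hG : IsFormalScheme (G ⋙ forget GrpCat.{u})) (C : Nilp (algebraMap 𝒪 R π)) :
    Function.Bijective (jetJetKernelHom φ m G C) := by
  have key : ∀ x : (jetKernel φ (m + 1) G).obj C, ∃! z : G.obj _,
      G.map (contractHom φ m C) z = x.1 ∧ G.map ((wittProj φ 1).app _) z = 1 := fun x =>
    (isNilSquare_contractHom φ m C).existsUnique hG x.1
      (1 : G.obj ((wittFunctor φ m).obj C)) (by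
        have h : G.map ((wittProj φ (m + 1)).app C) x.1 = 1 := x.2
        exact h.trans (map_one (G.map ((wittProj φ m).app C)).hom).symm)
  constructor
  · intro x y hxy
    exact Subtype.ext ((key (jetJetKernelHom φ m G C x)).unique ⟨rfl, x.2⟩
      ⟨congrArg Subtype.val hxy.symm, y.2⟩)
  · intro x
    obtain ⟨z, ⟨h1, h2⟩, -⟩ := key x
    exact ⟨⟨z, h2⟩, Subtype.ext h1⟩

/-- `J^m (N^1 G) ≃ N^{m+1} G`. -/
noncomputable def jetJetKernelIso (G : Nilp (algebraMap 𝒪 R π) ⥤ GrpCat.{u})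
    (hG : IsFormalScheme (G ⋙ forget GrpCat.{u})) :
    jet φ m (jetKernel φ 1 G) ≅ jetKernel φ (m + 1) G :=
  NatIso.ofComponents
    (fun C => (MulEquiv.ofBijective _ (jetJetKernelHom_bijective φ m G hG C)).toGrpIso) (by
    intro C D f
    ext x
    apply Subtype.ext
    have e := congrArg (fun g => G.map g x.1) (contractHom_naturality φ m f)
    simp only [G.map_comp] at e
    exact e)

end Assembly

theorem theoremt (p : ℕ) [Fact p.Prime]
    (K : Type*) [Field K] [Algebra ℚ_[p] K] [FiniteDimensional ℚ_[p] K]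
    [Algebra ℤ_[p] K] [IsScalarTower ℤ_[p] ℚ_[p] K]
    (π : integralClosure ℤ_[p] K) [Fact (Prime π)]
    (R : Type u) [CommRing R] [Algebra (integralClosure ℤ_[p] K) R] [PiTorsionFree π R]
    [IsAdicComplete (Ideal.span {algebraMap (integralClosure ℤ_[p] K) R π}) R]
    (φ : FrobLift π R)
    (G : Nilp (algebraMap (integralClosure ℤ_[p] K) R π) ⥤ GrpCat.{u})
    (hG : IsSmoothFormalGroupScheme G) (n : ℕ) (hn : 1 ≤ n) :
    Nonempty (jetKernel φ n G ≅ jet φ (n - 1) (jetKernel φ 1 G)) := by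
  obtain ⟨m, rfl⟩ : ∃ m, n = m + 1 := ⟨n - 1, by omega⟩
  exact ⟨(jetJetKernelIso φ m G hG.1).symm⟩
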